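/- Let $\mathbb{D}=\mathbb{C}\setminus\mathbb{R}$, let $\mathbb{H}=\mathbb{D}/\Sigma$ be its quotient by complex conjugation, $\Sigma=\mathrm{Gal}(\mathbb{C}/\mathbb{R})$, and let $p:\mathbb{D}\to\mathbb{H}$ be the quotient map. Let $\mathcal{O}$ be the sheaf of local $\mathbb{R}$-algebras on $\mathbb{H}$ whose sections over an open set $U$ are the holomorphic functions $f:p^{-1}(U)\to\mathbb{C}$ with $f(\bar z)=\overline{f(z)}$, and let $\mathcal{C}\supseteq\mathcal{O}$ be the sheaf whose sections over $U$ are the $C^\infty$ functions $f:p^{-1}(U)\to\mathbb{C}$ with $f(\bar z)=\overline{f(z)}$. A Klein surface is a locally ringed space $(S,\mathcal{O})$, with $\mathcal{O}$ a sheaf of local $\mathbb{R}$-algebras, such that $S$ is compact, connected and Hausdorff and $(S,\mathcal{O})$ is locally isomorphic to $(\mathbb{H},\mathcal{O})$ (as a locally ringed space over $\mathbb{R}$). Such an $S$ carries an induced sheaf $\mathcal{C}\supseteq\mathcal{O}$ of smooth functions, which corresponds to the sheaf $\mathcal{C}$ on $\mathbb{H}$ under every local isomorphism. A line bundle on $S$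 is an invertible (locally free of rank one) sheaf of $\mathcal{O}$-modules; a smooth line bundle on $S$ is an invertible sheaf of $\mathcal{C}$-modules. **Theorem 3.3.** Let $(S,\mathcal{O})$ be a Klein surface and let $\mathcal{C}$ be the induced sheaf of smooth functions on $S$. If $L'$ is a smooth line bundle on $S$, then there is a line bundle $L$ on $S$ such that $$L\otimes_{\mathcal{O}}\mathcal{C}\cong L'$$ as sheaves of $\mathcal{C}$-modules. -/

import Mathlib

open CategoryTheory TopologicalSpace Opposite AlgebraicGeometry
open scoped ContDiff TensorProduct

noncomputable section

namespace Klein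

/-- A rule selecting, for every open `U`, a subring of the families `(s x)_{x ∈ U}` with
`s x ∈ T x`, by a condition that is stable under restriction and local. -/
structure SectionRing {X : TopCat.{0}} (T : X → Type) [∀ x, CommRing (T x)] where
  ring : ∀ U : Opens X, Subring (∀ x : U, T x)
  res : ∀ {U V : Opens X} (i : V ≤ U) (s : ∀ x : U, T x), s ∈ ring U →
    (fun x : V => s ⟨x, i x.2⟩) ∈ ring V
  loc : ∀ {U : Opens X} (s : ∀ x : U, T x),
    (∀ x : U, ∃ (V : Opens X) (i : V ≤ U), x.1 ∈ V ∧ (fun y : V => s ⟨y, i y.2⟩) ∈ ring V) →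
      s ∈ ring U

namespace SectionRing

variable {X : TopCat.{0}} {T : X → Type} [∀ x, CommRing (T x)] (P : SectionRing T)

/-- The presheaf of rings `U ↦ P.ring U`, with restriction of families. -/
def presheaf : TopCat.Presheaf CommRingCat.{0} X where
  obj U := CommRingCat.of (P.ring U.unop)
  map {U V} i := CommRingCat.ofHom
    { toFun := fun s => ⟨fun x => s.1 ⟨x, leOfHom i.unop x.2⟩, P.res (leOfHom i.unop) s.1 s.2⟩
      map_one' := rfl
      map_mul' := fun _ _ => rfl
      map_zero' := rfl
      map_add' := fun _ _ => rfl }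
  map_id _ := rfl
  map_comp _ _ := rfl

theorem isSheaf : P.presheaf.IsSheaf := by
  refine (TopCat.Presheaf.isSheaf_iff_isSheaf_comp (forget CommRingCat) _).2 ?_
  refine TopCat.Presheaf.isSheaf_of_isSheafUniqueGluing_types _ ?_
  intro ι U sf hsf
  have hsf' : ∀ (i j : ι) (x : X) (hi : x ∈ U i) (hj : x ∈ U j),
      (sf i).1 ⟨x, hi⟩ = (sf j).1 ⟨x, hj⟩ := by
    intro i j x hi hj
    exact congrFun (congrArg Subtype.val (hsf i j)) ⟨x, ⟨hi, hj⟩⟩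
  have hex : ∀ x : (iSup U : Opens X), ∃ i, x.1 ∈ U i := fun x => Opens.mem_iSup.1 x.2
  choose c hc using hex
  refine ⟨⟨fun x => (sf (c x)).1 ⟨x.1, hc x⟩, P.loc _ fun x => ⟨U (c x), le_iSup U _, hc x, ?_⟩⟩,
    ?_, ?_⟩
  · convert (sf (c x)).2 using 1
    funext y
    exact hsf' _ _ _ _ _
  · intro i
    refine Subtype.ext (funext fun y => ?_)
    exact hsf' _ _ _ _ _
  · intro t ht
    refine Subtype.ext (funext fun y => ?_)
    exact congrFun (congrArg Subtype.val (ht (c y))) ⟨y.1, hc y⟩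

end SectionRing


/-- The double open half plane `𝔻 = ℂ ∖ ℝ`. -/
abbrev DoubleHalfPlane : Type := {z : ℂ // z.im ≠ 0}

namespace DoubleHalfPlane

/-- Complex conjugation on `ℂ ∖ ℝ`. -/
def conj (z : DoubleHalfPlane) : DoubleHalfPlane :=
  ⟨starRingEnd ℂ z.1, by simpa using z.2⟩

theorem conj_conj (z : DoubleHalfPlane) : conj (conj z) = z :=
  Subtype.ext (Complex.conj_conj z.1)

theorem continuous_conj : Continuous conj :=
  Continuous.subtype_mk (Complex.continuous_conj.comp continuous_subtype_val) _

/-- Two points are equivalent if they are in the same orbit of complex conjugation. -/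
def orbitSetoid : Setoid DoubleHalfPlane where
  r z w := w = z ∨ w = conj z
  iseqv :=
    { refl := fun _ => Or.inl rfl
      symm := by
        rintro z w (rfl | rfl)
        · exact Or.inl rfl
        · exact Or.inr (conj_conj z).symm
      trans := by
        rintro z w v (rfl | rfl) (rfl | rfl)
        · exact Or.inl rfl
        · exact Or.inr rfl
        · exact Or.inr rfl
        · exact Or.inl (conj_conj z) }

end DoubleHalfPlane

open DoubleHalfPlane

/-- The quotient space `ℍ = 𝔻/Σ` of `ℂ ∖ ℝ` by complex conjugation, with the quotient topology. -/
abbrev KleinPlane : TopCat.{0} := TopCat.of (Quotient DoubleHalfPlane.orbitSetoid)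

namespace KleinPlane

/-- The quotient map `p : 𝔻 → ℍ`. -/
def proj (z : DoubleHalfPlane) : KleinPlane := Quotient.mk DoubleHalfPlane.orbitSetoid z

theorem continuous_proj : Continuous proj := continuous_quotient_mk'

theorem proj_surjective : Function.Surjective proj := Quotient.mk_surjective

theorem proj_conj (z : DoubleHalfPlane) : proj (conj z) = proj z :=
  Quotient.sound (s := DoubleHalfPlane.orbitSetoid) (Or.inr (conj_conj z).symm)

theorem eq_or_eq_conj {z w : DoubleHalfPlane} (h : proj w = proj z) : w = z ∨ w = conj z :=
  Quotient.exact (s := DoubleHalfPlane.orbitSetoid) h.symm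

/-- The preimage `p⁻¹(U)`, as a subset of `ℂ`. -/
def lift (U : Set KleinPlane) : Set ℂ := {z | ∃ h : z.im ≠ 0, proj ⟨z, h⟩ ∈ U}

theorem isOpen_lift (U : Opens KleinPlane) : IsOpen (lift U) := by
  have h1 : IsOpen {z : ℂ | z.im ≠ 0} := isOpen_ne_fun Complex.continuous_im continuous_const
  have h2 := h1.isOpenMap_subtype_val _ (U.2.preimage continuous_proj)
  convert h2 using 1
  ext z
  constructor
  · rintro ⟨h, hz⟩; exact ⟨⟨z, h⟩, hz, rfl⟩
  · rintro ⟨⟨w, h⟩, hz, rfl⟩; exact ⟨h, hz⟩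

/-- The fibre of `p` over a point. -/
abbrev Fibre (x : KleinPlane) : Type := {z : DoubleHalfPlane // proj z = x}

/-- A family `(f x)_{x ∈ U}` of functions on the fibres `p⁻¹(x)` is the same thing as a complex
function `z ↦ f (p z) z` on `p⁻¹(U)`; this is its value at `z`. -/
def value {U : Opens KleinPlane} (f : ∀ x : U, Fibre x.1 → ℂ) (z : DoubleHalfPlane)
    (hz : proj z ∈ U) : ℂ := f ⟨proj z, hz⟩ ⟨z, rfl⟩

theorem apply_eq_value {U : Opens KleinPlane} (f : ∀ x : U, Fibre x.1 → ℂ) {x : KleinPlane}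
    (hx : x ∈ U) (w : DoubleHalfPlane) (hw : proj w = x) :
    f ⟨x, hx⟩ ⟨w, hw⟩ = value f w (hw.symm ▸ hx) := by
  subst hw; rfl

/-- A function `f` on `p⁻¹(U)` is an element of `(p_* 𝓗)^Σ (U)` if it is holomorphic
and satisfies `f (conj z) = conj (f z)`. -/
def IsInvariantHolomorphic {U : Opens KleinPlane} (f : ∀ x : U, Fibre x.1 → ℂ) : Prop :=
  (∃ g : ℂ → ℂ, DifferentiableOn ℂ g (lift U) ∧ ∀ z hz, value f z hz = g z.1) ∧
  ∀ z (hz : proj z ∈ U), value f (conj z) ((proj_conj z).symm ▸ hz) = starRingEnd ℂ (value f z hz)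

theorem IsInvariantHolomorphic.loc {U : Opens KleinPlane} (f : ∀ x : U, Fibre x.1 → ℂ)
    (H : ∀ x : U, ∃ (V : Opens KleinPlane) (i : V ≤ U), x.1 ∈ V ∧
      IsInvariantHolomorphic (U := V) (fun y : V => f ⟨y, i y.2⟩)) :
    IsInvariantHolomorphic f := by
  classical
  refine ⟨⟨fun z => if h : z ∈ lift U then value f ⟨z, h.1⟩ h.2 else 0, ?_, ?_⟩, ?_⟩
  · rintro z ⟨hz, hzU⟩
    obtain ⟨V, i, hzV, ⟨g, hg, hgf⟩, -⟩ := H ⟨_, hzU⟩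
    have hV : lift V ∈ nhds z := (isOpen_lift V).mem_nhds ⟨hz, hzV⟩
    refine DifferentiableAt.differentiableWithinAt ?_
    refine ((hg z ⟨hz, hzV⟩).differentiableAt hV).congr_of_eventuallyEq ?_
    filter_upwards [hV] with w hw
    rw [dif_pos ⟨hw.1, i hw.2⟩, ← hgf ⟨w, hw.1⟩ hw.2]
    rfl
  · intro z hz
    have h : z.1 ∈ lift U := ⟨z.2, hz⟩
    change _ = if h : z.1 ∈ lift U then value f ⟨z.1, h.1⟩ h.2 else 0
    rw [dif_pos h]
  · intro z hz
    obtain ⟨V, i, hzV, -, hc⟩ := H ⟨_, hz⟩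
    exact hc z hzV

/-- The rings of sections of the sheaf `𝒪 = (p_* 𝓗)^Σ` on `ℍ`, where `Σ` acts by
`f ↦ (z ↦ conj (f (conj z)))`. -/
def sections : SectionRing (X := KleinPlane) (fun x => Fibre x → ℂ) where
  ring U :=
    { carrier := {f | IsInvariantHolomorphic f}
      mul_mem' := by
        rintro f f' ⟨⟨g, hg, hgf⟩, hc⟩ ⟨⟨g', hg', hgf'⟩, hc'⟩
        refine ⟨⟨g * g', hg.mul hg', fun z hz => ?_⟩, fun z hz => ?_⟩
        · exact congrArg₂ (· * ·) (hgf z hz) (hgf' z hz)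
        · exact (congrArg₂ (· * ·) (hc z hz) (hc' z hz)).trans (map_mul _ _ _).symm
      one_mem' := ⟨⟨1, differentiableOn_const 1, fun _ _ => rfl⟩, fun _ _ => (map_one _).symm⟩
      add_mem' := by
        rintro f f' ⟨⟨g, hg, hgf⟩, hc⟩ ⟨⟨g', hg', hgf'⟩, hc'⟩
        refine ⟨⟨g + g', hg.add hg', fun z hz => ?_⟩, fun z hz => ?_⟩
        · exact congrArg₂ (· + ·) (hgf z hz) (hgf' z hz)
        · exact (congrArg₂ (· + ·) (hc z hz) (hc' z hz)).trans (map_add _ _ _).symm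
      zero_mem' := ⟨⟨0, differentiableOn_const 0, fun _ _ => rfl⟩, fun _ _ => (map_zero _).symm⟩
      neg_mem' := by
        rintro f ⟨⟨g, hg, hgf⟩, hc⟩
        refine ⟨⟨-g, hg.neg, fun z hz => ?_⟩, fun z hz => ?_⟩
        · exact congrArg (- ·) (hgf z hz)
        · exact (congrArg (- ·) (hc z hz)).trans (map_neg _ _).symm }
  res := by
    rintro U V i f ⟨⟨g, hg, hgf⟩, hc⟩
    refine ⟨⟨g, hg.mono fun z hz => ⟨hz.1, i hz.2⟩, fun z hz => hgf z (i hz)⟩,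
      fun z hz => hc z (i hz)⟩
  loc := fun f H => IsInvariantHolomorphic.loc f H

/-- Evaluation of sections at `z ∈ p⁻¹(U)`. -/
def evalAt (U : Opens KleinPlane) (z : DoubleHalfPlane) (hz : proj z ∈ U) :
    sections.presheaf.obj (op U) →+* ℂ where
  toFun f := value f.1 z hz
  map_one' := rfl
  map_mul' _ _ := rfl
  map_zero' := rfl
  map_add' _ _ := rfl

open Limits in
/-- The evaluations at `z`, as a cocone. -/
def evalCocone (z : DoubleHalfPlane) :
    Cocone ((OpenNhds.inclusion (proj z)).op ⋙ sections.presheaf) where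
  pt := CommRingCat.of ℂ
  ι := { app := fun U => CommRingCat.ofHom (evalAt U.unop.1 z U.unop.2)
         naturality := fun _ _ _ => rfl }

open Limits in
/-- Evaluation of germs at `z`. -/
def evalStalk (z : DoubleHalfPlane) : sections.presheaf.stalk (proj z) →+* ℂ :=
  (colimit.desc _ (evalCocone z)).hom

open Limits in
theorem evalStalk_germ (z : DoubleHalfPlane) (U : Opens KleinPlane) (hz : proj z ∈ U)
    (f : sections.presheaf.obj (op U)) :
    evalStalk z (sections.presheaf.germ U (proj z) hz f) = value f.1 z hz :=
  ConcreteCategory.congr_hom (colimit.ι_desc (evalCocone z) (op (⟨U, hz⟩ : OpenNhds (proj z)))) f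

theorem isUnit_iff_evalStalk (z : DoubleHalfPlane) (s : sections.presheaf.stalk (proj z)) :
    IsUnit s ↔ evalStalk z s ≠ 0 := by
  classical
  refine ⟨fun h => (h.map (evalStalk z)).ne_zero, fun h => ?_⟩
  obtain ⟨U, hzU, f, rfl⟩ := sections.presheaf.exists_germ_eq s
  rw [evalStalk_germ] at h
  obtain ⟨⟨g, hg, hgf⟩, hc⟩ := f.2
  let V : Opens KleinPlane :=
    ⟨{x | ∃ hx : x ∈ U, ∀ w : Fibre x, f.1 ⟨x, hx⟩ w ≠ 0}, by
      refine isOpen_coinduced.2 ?_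
      have h1 : IsOpen (lift U ∩ g ⁻¹' {0}ᶜ) :=
        hg.continuousOn.isOpen_inter_preimage (isOpen_lift U) isOpen_compl_singleton
      convert h1.preimage continuous_subtype_val using 1
      ext w
      constructor
      · rintro ⟨hw, hw'⟩
        refine ⟨⟨w.2, hw⟩, ?_⟩
        have : g w.1 ≠ 0 := hgf w hw ▸ hw' ⟨w, rfl⟩
        exact this
      · rintro ⟨hw, hw'⟩
        have h0 : value f.1 w hw.2 ≠ 0 := by rw [hgf w hw.2]; exact hw'
        refine ⟨hw.2, ?_⟩
        rintro ⟨v, hv⟩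
        obtain rfl | rfl := eq_or_eq_conj hv
        · exact h0
        · have h2 := hc w hw.2
          intro h3
          apply h0
          rw [← map_eq_zero (starRingEnd ℂ), ← h2]
          exact (apply_eq_value f.1 hw.2 _ hv).symm.trans h3⟩
  have hzV : proj z ∈ V := by
    refine ⟨hzU, ?_⟩
    rintro ⟨v, hv⟩
    obtain rfl | rfl := eq_or_eq_conj hv
    · exact h
    · intro h3
      apply h
      rw [← map_eq_zero (starRingEnd ℂ), ← hc z hzU]
      exact (apply_eq_value f.1 hzU _ hv).symm.trans h3
  have hVU : V ≤ U := fun x hx => hx.1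
  let e : sections.presheaf.obj (op V) := ⟨fun x w => (f.1 ⟨x.1, hVU x.2⟩ w)⁻¹, by
    refine ⟨⟨fun w => (g w)⁻¹, ?_, fun w hw => ?_⟩, fun w hw => ?_⟩
    · refine (hg.mono fun w hw => ⟨hw.1, hVU hw.2⟩).inv fun w hw => ?_
      have := hw.2.2 ⟨⟨w, hw.1⟩, rfl⟩
      rw [← hgf ⟨w, hw.1⟩ (hVU hw.2)]
      exact this
    · exact congrArg (·⁻¹) (hgf w (hVU hw))
    · exact (congrArg (·⁻¹) (hc w (hVU hw))).trans (map_inv₀ _ _).symm⟩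
  have hmul : sections.presheaf.map (homOfLE hVU).op f * e = 1 := by
    refine Subtype.ext (funext fun x => funext fun w => ?_)
    exact mul_inv_cancel₀ (x.2.2 w)
  have hu := congrArg (sections.presheaf.germ V (proj z) hzV) hmul
  rw [map_mul, map_one, TopCat.Presheaf.germ_res_apply] at hu
  exact IsUnit.of_mul_eq_one _ hu

instance (z : DoubleHalfPlane) : IsLocalHom (evalStalk z) :=
  ⟨fun s hs => (isUnit_iff_evalStalk z s).2 hs.ne_zero⟩

theorem isLocalRing_stalk (x : KleinPlane) : IsLocalRing (sections.presheaf.stalk x) := by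
  obtain ⟨z, rfl⟩ := proj_surjective x
  exact (evalStalk z).domain_isLocalRing

/-- The locally ringed space `(ℍ, 𝒪)`. -/
def locallyRingedSpace : LocallyRingedSpace.{0} where
  carrier := KleinPlane
  presheaf := sections.presheaf
  IsSheaf := sections.isSheaf
  isLocalRing := isLocalRing_stalk

/-- The structure of `ℝ`-algebra of `𝒪` : real constants. -/
def scalars : ℝ →+* LocallyRingedSpace.Γ.obj (op locallyRingedSpace) where
  toFun c := ⟨fun _ _ => (c : ℂ), ⟨fun _ => (c : ℂ), differentiableOn_const _, fun _ _ => rfl⟩,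
    fun _ _ => (Complex.conj_ofReal c).symm⟩
  map_one' := Subtype.ext (funext fun _ => funext fun _ => Complex.ofReal_one)
  map_mul' a b := Subtype.ext (funext fun _ => funext fun _ => Complex.ofReal_mul a b)
  map_zero' := Subtype.ext (funext fun _ => funext fun _ => Complex.ofReal_zero)
  map_add' a b := Subtype.ext (funext fun _ => funext fun _ => Complex.ofReal_add a b)

end KleinPlane
section Tensor

/-- For a commutative square of ring maps, `b ∘ f = f' ∘ a`, and an `a`-semilinear `g : M → M'`, the
`b`-semilinear map `B ⊗[A] M → B' ⊗[A'] M'`, `s ⊗ m ↦ b s ⊗ g m`. -/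
def tensorSemilinear {A B A' B' : Type} [CommRing A] [CommRing B] [CommRing A'] [CommRing B']
    [Algebra A B] [Algebra A' B'] {a : A →+* A'} {b : B →+* B'}
    (h : b.comp (algebraMap A B) = (algebraMap A' B').comp a)
    {M M' : Type} [AddCommGroup M] [Module A M] [AddCommGroup M'] [Module A' M']
    (g : M →ₛₗ[a] M') : B ⊗[A] M →ₛₗ[b] B' ⊗[A'] M' :=
  let F : B ⊗[A] M →+ B' ⊗[A'] M' := TensorProduct.liftAddHom
    { toFun := fun s =>
        { toFun := fun m => b s ⊗ₜ[A'] g m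
          map_zero' := by rw [map_zero, TensorProduct.tmul_zero]
          map_add' := fun m n => by rw [map_add, TensorProduct.tmul_add] }
      map_zero' := by ext m; simp
      map_add' := fun s t => by ext m; simp [TensorProduct.add_tmul] }
    (fun r s m => by
      have h1 : b (r • s) = a r • b s := by
        rw [Algebra.smul_def, Algebra.smul_def, map_mul]
        exact congrArg (· * b s) (RingHom.congr_fun h r)
      simp [h1, TensorProduct.smul_tmul])
  { toFun := F
    map_add' := F.map_add
    map_smul' := fun t x => by
      induction x using TensorProduct.induction_on with
      | zero => rw [smul_zero, map_zero, smul_zero]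
      | add x y hx hy => rw [smul_add, map_add, map_add, smul_add, hx, hy]
      | tmul s m => simp [F, TensorProduct.smul_tmul'] }

theorem tensorSemilinear_tmul {A B A' B' : Type} [CommRing A] [CommRing B] [CommRing A']
    [CommRing B'] [Algebra A B] [Algebra A' B'] {a : A →+* A'} {b : B →+* B'}
    (h : b.comp (algebraMap A B) = (algebraMap A' B').comp a)
    {M M' : Type} [AddCommGroup M] [Module A M] [AddCommGroup M'] [Module A' M']
    (g : M →ₛₗ[a] M') (s : B) (m : M) :
    tensorSemilinear h g (s ⊗ₜ[A] m) = b s ⊗ₜ[A'] g m := rfl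

variable {C : Type*} [Category* C] {R S : Cᵒᵖ ⥤ CommRingCat.{0}} 

theorem naturality_comp (φ : R ⟶ S) {U V : Cᵒᵖ} (f : U ⟶ V) :
    letI := (φ.app U).hom.toAlgebra
    letI := (φ.app V).hom.toAlgebra
    (S.map f).hom.comp (algebraMap (R.obj U) (S.obj U)) =
      (algebraMap (R.obj V) (S.obj V)).comp (R.map f).hom := by
  let := (φ.app U).hom.toAlgebra
  let := (φ.app V).hom.toAlgebra
  refine RingHom.ext fun r => ?_
  exact (NatTrans.naturality_apply φ f r).symm

/-- The restriction map `S(U) ⊗ M(U) → S(V) ⊗ M(V)`, `s ⊗ m ↦ s|_V ⊗ m|_V`. -/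
def tensorRestrict (φ : R ⟶ S) (M : PresheafOfModules.{0} (R ⋙ forget₂ CommRingCat RingCat))
    {U V : Cᵒᵖ} (f : U ⟶ V) :
    letI := (φ.app U).hom.toAlgebra
    letI := (φ.app V).hom.toAlgebra
    S.obj U ⊗[R.obj U] M.obj U →ₛₗ[(S.map f).hom] S.obj V ⊗[R.obj V] M.obj V :=
  letI := (φ.app U).hom.toAlgebra
  letI := (φ.app V).hom.toAlgebra
  tensorSemilinear (a := (R.map f).hom) (naturality_comp φ f) (M.restrictₛₗ f)

theorem tensorRestrict_tmul (φ : R ⟶ S)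
    (M : PresheafOfModules.{0} (R ⋙ forget₂ CommRingCat RingCat))
    {U V : Cᵒᵖ} (f : U ⟶ V) (s : S.obj U) (m : M.obj U) :
    letI := (φ.app U).hom.toAlgebra
    letI := (φ.app V).hom.toAlgebra
    tensorRestrict φ M f (s ⊗ₜ[R.obj U] m) = (S.map f).hom s ⊗ₜ[R.obj V] M.restrictₛₗ f m :=
  let := (φ.app U).hom.toAlgebra
  let := (φ.app V).hom.toAlgebra
  tensorSemilinear_tmul (naturality_comp φ f) (M.restrictₛₗ f) s m


theorem tensorRestrict_id (φ : R ⟶ S)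
    (M : PresheafOfModules.{0} (R ⋙ forget₂ CommRingCat RingCat)) (U : Cᵒᵖ) :
    letI := (φ.app U).hom.toAlgebra
    ∀ x : S.obj U ⊗[R.obj U] M.obj U, tensorRestrict φ M (𝟙 U) x = x := by
  let := (φ.app U).hom.toAlgebra
  intro x
  induction x using TensorProduct.induction_on with
  | zero => exact map_zero _
  | add x y hx hy => exact (map_add _ x y).trans (congrArg₂ (· + ·) hx hy)
  | tmul s m =>
    have h1 : (S.map (𝟙 U)).hom s = s := by rw [S.map_id]; rfl
    have h2 : M.restrictₛₗ (𝟙 U) m = m := by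
      have := ConcreteCategory.congr_hom (M.map_id U) m
      exact this
    rw [tensorRestrict_tmul, h1, h2]

theorem tensorRestrict_comp (φ : R ⟶ S)
    (M : PresheafOfModules.{0} (R ⋙ forget₂ CommRingCat RingCat))
    {U V W : Cᵒᵖ} (f : U ⟶ V) (g : V ⟶ W) :
    letI := (φ.app U).hom.toAlgebra
    letI := (φ.app V).hom.toAlgebra
    letI := (φ.app W).hom.toAlgebra
    ∀ x : S.obj U ⊗[R.obj U] M.obj U,
      tensorRestrict φ M (f ≫ g) x = tensorRestrict φ M g (tensorRestrict φ M f x) := by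
  let := (φ.app U).hom.toAlgebra
  let := (φ.app V).hom.toAlgebra
  let := (φ.app W).hom.toAlgebra
  intro x
  induction x using TensorProduct.induction_on with
  | zero => simp only [map_zero]
  | add x y hx hy => simp only [map_add, hx, hy]
  | tmul s m =>
    have h1 : (S.map (f ≫ g)).hom s = (S.map g).hom ((S.map f).hom s) := by
      rw [S.map_comp]; rfl
    have h2 : M.restrictₛₗ (f ≫ g) m = M.restrictₛₗ g (M.restrictₛₗ f m) :=
      M.map_comp_apply f g m
    rw [tensorRestrict_tmul, tensorRestrict_tmul, tensorRestrict_tmul, h1, h2]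

/-- The `S(U)`-module `S(U) ⊗_{R(U)} M(U)`. -/
def tensorObj (φ : R ⟶ S) (M : PresheafOfModules.{0} (R ⋙ forget₂ CommRingCat RingCat))
    (U : Cᵒᵖ) : ModuleCat.{0} ((S ⋙ forget₂ CommRingCat RingCat).obj U) :=
  letI := (φ.app U).hom.toAlgebra
  ModuleCat.of (S.obj U) (S.obj U ⊗[R.obj U] M.obj U)

/-- `tensorRestrict` as a morphism of modules. -/
def tensorMap (φ : R ⟶ S) (M : PresheafOfModules.{0} (R ⋙ forget₂ CommRingCat RingCat))
    {U V : Cᵒᵖ} (f : U ⟶ V) :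
    tensorObj φ M U ⟶ (ModuleCat.restrictScalars
      ((S ⋙ forget₂ CommRingCat RingCat).map f).hom).obj (tensorObj φ M V) :=
  ModuleCat.ofHom (X := tensorObj φ M U) (Y := (ModuleCat.restrictScalars
      ((S ⋙ forget₂ CommRingCat RingCat).map f).hom).obj (tensorObj φ M V))
    { toFun := tensorRestrict φ M f
      map_add' := (tensorRestrict φ M f).map_add
      map_smul' := (tensorRestrict φ M f).map_smulₛₗ }

theorem tensorMap_apply (φ : R ⟶ S) (M : PresheafOfModules.{0} (R ⋙ forget₂ CommRingCat RingCat))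
    {U V : Cᵒᵖ} (f : U ⟶ V) (x : tensorObj φ M U) :
    tensorMap φ M f x = tensorRestrict φ M f x := rfl

theorem tensorMap_id (φ : R ⟶ S) (M : PresheafOfModules.{0} (R ⋙ forget₂ CommRingCat RingCat))
    (U : Cᵒᵖ) (x : tensorObj φ M U) : tensorMap φ M (𝟙 U) x = x :=
  (tensorMap_apply φ M (𝟙 U) x).trans (tensorRestrict_id φ M U x)

theorem tensorMap_comp (φ : R ⟶ S)
    (M : PresheafOfModules.{0} (R ⋙ forget₂ CommRingCat RingCat))
    {U V W : Cᵒᵖ} (f : U ⟶ V) (g : V ⟶ W) (x : tensorObj φ M U) :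
    tensorMap φ M (f ≫ g) x = tensorMap φ M g (tensorMap φ M f x) :=
  (tensorMap_apply φ M (f ≫ g) x).trans ((tensorRestrict_comp φ M f g x).trans
    ((congrArg (tensorRestrict φ M g) (tensorMap_apply φ M f x)).symm.trans
      (tensorMap_apply φ M g _).symm))

/-- The presheaf tensor product `U ↦ S(U) ⊗_{R(U)} M(U)`, as a presheaf of `S`-modules. -/
def presheafExtendScalars (φ : R ⟶ S)
    (M : PresheafOfModules.{0} (R ⋙ forget₂ CommRingCat RingCat)) :
    PresheafOfModules.{0} (S ⋙ forget₂ CommRingCat RingCat) where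
  obj U := tensorObj φ M U
  map f := tensorMap φ M f
  map_id U := ModuleCat.hom_ext (LinearMap.ext fun x => tensorMap_id φ M U x)
  map_comp f g := ModuleCat.hom_ext (LinearMap.ext fun x => tensorMap_comp φ M f g x)

end Tensor

section Modules

variable {X : TopCat.{0}}

/-- A sheaf of commutative rings, regarded as a sheaf of rings. -/
abbrev ringSheaf (R : TopCat.Sheaf CommRingCat.{0} X) : TopCat.Sheaf RingCat.{0} X :=
  (sheafCompose _ (forget₂ CommRingCat RingCat)).obj R

/-- The sheaf of `S`-modules `M ⊗_R S`, for a morphism `φ : R ⟶ S` of sheaves of commutative rings: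
the sheaf associated with the presheaf `U ↦ S(U) ⊗_{R(U)} M(U)`. -/
def sheafExtendScalars {R S : TopCat.Sheaf CommRingCat.{0} X} (φ : R ⟶ S)
    (M : SheafOfModules.{0} (ringSheaf R)) : SheafOfModules.{0} (ringSheaf S) :=
  (PresheafOfModules.sheafification (𝟙 (ringSheaf S).obj)).obj
    (presheafExtendScalars φ.hom M.val)

/-- Invertible sheaves of modules, that is, sheaves of modules that are locally free of rank one:
every point has an open neighbourhood `U` with a section `e` of `M` over `U` such that `r ↦ r • e`
is an isomorphism `R|_U ≅ M|_U`. -/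
def IsInvertibleSheaf {R : TopCat.Sheaf CommRingCat.{0} X} (M : SheafOfModules.{0} (ringSheaf R)) :
    Prop :=
  ∀ x : X, ∃ (U : Opens X) (_ : x ∈ U) (e : M.val.obj (op U)), ∀ (V : Opens X) (i : V ≤ U),
    Function.Bijective fun r : (ringSheaf R).obj.obj (op V) =>
      (r • (M.val.map (homOfLE i).op e : M.val.obj (op V)) : M.val.obj (op V))

end Modules

/-- A locally ringed space whose structure sheaf is a sheaf of `ℝ`-algebras; this structure is
given by the ring homomorphism from `ℝ` to the ring of global sections. -/
structure RealRingedSpace where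
  toLRS : LocallyRingedSpace.{0}
  scalars : ℝ →+* LocallyRingedSpace.Γ.obj (op toLRS)

/-- An isomorphism, of locally ringed spaces over `ℝ`, from an open subspace `(W, 𝒪|_W)` of
`(ℍ, 𝒪)` onto an open subspace of `X`. -/
structure KleinChart (X : RealRingedSpace) where
  domain : Opens KleinPlane
  hom : KleinPlane.locallyRingedSpace.restrict domain.isOpenEmbedding ⟶ X.toLRS
  isOpenImmersion : LocallyRingedSpace.IsOpenImmersion hom
  map_scalars : (LocallyRingedSpace.Γ.map hom.op).hom.comp X.scalars =
    (LocallyRingedSpace.Γ.map (KleinPlane.locallyRingedSpace.ofRestrict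
      domain.isOpenEmbedding).op).hom.comp KleinPlane.scalars

namespace KleinChart

variable {X : RealRingedSpace} (c : KleinChart X)

/-- The point of `X` with parameter `p z ∈ W`. -/
def point (z : DoubleHalfPlane) (hz : KleinPlane.proj z ∈ c.domain) : X.toLRS :=
  c.hom.base ⟨KleinPlane.proj z, hz⟩

/-- The ring homomorphism from the stalk at `point z` to `ℂ` given by pulling germs back to `ℍ`
and evaluating them at `z`. -/
def evalStalk (z : DoubleHalfPlane) (hz : KleinPlane.proj z ∈ c.domain) :
    X.toLRS.presheaf.stalk (c.point z hz) →+* ℂ :=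
  (KleinPlane.evalStalk z).comp
    ((KleinPlane.locallyRingedSpace.restrictStalkIso c.domain.isOpenEmbedding
      ⟨KleinPlane.proj z, hz⟩).hom.hom.comp (c.hom.stalkMap ⟨KleinPlane.proj z, hz⟩).hom)

instance (z : DoubleHalfPlane) (hz : KleinPlane.proj z ∈ c.domain) :
    IsLocalHom (c.evalStalk z hz) := by
  have h1 : IsLocalHom (c.hom.stalkMap ⟨KleinPlane.proj z, hz⟩).hom := c.hom.prop _
  have h2 : IsLocalHom (KleinPlane.locallyRingedSpace.restrictStalkIso c.domain.isOpenEmbedding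
      ⟨KleinPlane.proj z, hz⟩).hom.hom := inferInstance
  have h3 : IsLocalHom (KleinPlane.evalStalk z) := inferInstance
  exact @RingHom.isLocalHom_comp _ _ _ _ _ _ _ _ h3 (@RingHom.isLocalHom_comp _ _ _ _ _ _ _ _ h2 h1)

/-- The embedding into `ℂ` of the residue field at `point z` that is induced by `evalStalk`. -/
def evalResidue (z : DoubleHalfPlane) (hz : KleinPlane.proj z ∈ c.domain) :
    X.toLRS.residueField (c.point z hz) →+* ℂ :=
  IsLocalRing.ResidueField.lift (c.evalStalk z hz)

/-- The set of the `z` in `p⁻¹(W)` whose image in `X` belongs to `U`. -/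
def preimage (U : Opens X.toLRS) : Set ℂ :=
  {z | ∃ (h : z.im ≠ 0) (hz : KleinPlane.proj ⟨z, h⟩ ∈ c.domain), c.point ⟨z, h⟩ hz ∈ U}

theorem preimage_eq (U : Opens X.toLRS) : c.preimage U =
    KleinPlane.lift (c.domain.isOpenEmbedding.isOpenMap.functor.obj
      ((Opens.map c.hom.base).obj U) : Opens KleinPlane) := by
  ext z
  constructor
  · rintro ⟨h, hz, hU⟩
    exact ⟨h, ⟨_, hz⟩, hU, rfl⟩
  · rintro ⟨h, ⟨w, hz⟩, hU, rfl⟩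
    exact ⟨h, hz, hU⟩

theorem isOpen_preimage (U : Opens X.toLRS) : IsOpen (c.preimage U) := by
  rw [preimage_eq]; exact KleinPlane.isOpen_lift _

theorem evalResidue_evaluation (U : Opens X.toLRS) (f : X.toLRS.presheaf.obj (op U))
    (z : DoubleHalfPlane) (hz : KleinPlane.proj z ∈ c.domain) (hU : c.point z hz ∈ U) :
    c.evalResidue z hz (X.toLRS.evaluation ⟨c.point z hz, hU⟩ f) =
      KleinPlane.value (U := c.domain.isOpenEmbedding.isOpenMap.functor.obj
        ((Opens.map c.hom.base).obj U))
        (Subtype.val (c.hom.c.app (op U) f : KleinPlane.sections.presheaf.obj (op _))) z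
        ⟨⟨_, hz⟩, hU, rfl⟩ := by
  have h1 : c.evalResidue z hz (X.toLRS.evaluation ⟨c.point z hz, hU⟩ f) =
      c.evalStalk z hz (X.toLRS.presheaf.germ U (c.point z hz) hU f) :=
    IsLocalRing.ResidueField.lift_residue_apply (c.evalStalk z hz)
      (X.toLRS.presheaf.germ U (c.point z hz) hU f)
  have h2 : (c.hom.stalkMap ⟨KleinPlane.proj z, hz⟩)
      (X.toLRS.presheaf.germ U (c.point z hz) hU f) = _ :=
    LocallyRingedSpace.stalkMap_germ_apply c.hom U ⟨KleinPlane.proj z, hz⟩ hU f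
  rw [h1]
  change KleinPlane.evalStalk z ((KleinPlane.locallyRingedSpace.restrictStalkIso
    c.domain.isOpenEmbedding ⟨KleinPlane.proj z, hz⟩).hom ((c.hom.stalkMap
      ⟨KleinPlane.proj z, hz⟩) (X.toLRS.presheaf.germ U (c.point z hz) hU f))) = _
  rw [h2]
  have h3 := LocallyRingedSpace.restrictStalkIso_hom_eq_germ_apply KleinPlane.locallyRingedSpace
    c.domain.isOpenEmbedding ((Opens.map c.hom.base).obj U) ⟨KleinPlane.proj z, hz⟩ hU
    (c.hom.c.app (op U) f)
  refine (congrArg (KleinPlane.evalStalk z) h3).trans ?_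
  exact KleinPlane.evalStalk_germ _ _ _ _

end KleinChart

/-- For a section `f` of `𝒪` over `U`, the values `f(x)` in the residue fields `κ(x)` form a family
`(s x)_{x ∈ U}` with `s x ∈ κ(x)`. Such a family is smooth if, read in every local isomorphism `ψ`
from an open subset `W` of `ℍ` to `X` through the embeddings `κ(ψ (p z)) → ℂ`, it is a `C^∞` complex
valued function of `z` in the open set `p⁻¹(W ∩ ψ⁻¹(U))`. Since `κ(ψ (p z)) → ℂ` is an isomorphism
which is replaced by its complex conjugate when `z` is replaced by `conj z`, the families over
`ψ(W)` are the functions on `p⁻¹(W)` that are invariant under `f ↦ (z ↦ conj (f (conj z)))`. -/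
def IsSmoothFamily {X : RealRingedSpace} {U : Opens X.toLRS}
    (s : ∀ x : U, X.toLRS.residueField x.1) : Prop :=
  ∀ c : KleinChart X, ∃ g : ℂ → ℂ, ContDiffOn ℝ ∞ g (c.preimage U) ∧
    ∀ z hz (hU : c.point z hz ∈ U), c.evalResidue z hz (s ⟨c.point z hz, hU⟩) = g z.1

/-- The subrings of smooth families. -/
def smoothSections (X : RealRingedSpace) :
    SectionRing (X := X.toLRS.toTopCat) (fun x => X.toLRS.residueField x) where
  ring U :=
    { carrier := {s | IsSmoothFamily s}
      mul_mem' := by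
        intro s s' hs hs' c
        obtain ⟨g, hg, h⟩ := hs c
        obtain ⟨g', hg', h'⟩ := hs' c
        refine ⟨g * g', hg.mul hg', fun z hz hU => ?_⟩
        exact (map_mul _ _ _).trans (congrArg₂ (· * ·) (h z hz hU) (h' z hz hU))
      one_mem' := fun c => ⟨1, contDiffOn_const, fun _ _ _ => map_one _⟩
      add_mem' := by
        intro s s' hs hs' c
        obtain ⟨g, hg, h⟩ := hs c
        obtain ⟨g', hg', h'⟩ := hs' c
        refine ⟨g + g', hg.add hg', fun z hz hU => ?_⟩
        exact (map_add _ _ _).trans (congrArg₂ (· + ·) (h z hz hU) (h' z hz hU))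
      zero_mem' := fun c => ⟨0, contDiffOn_const, fun _ _ _ => map_zero _⟩
      neg_mem' := by
        intro s hs c
        obtain ⟨g, hg, h⟩ := hs c
        refine ⟨-g, hg.neg, fun z hz hU => ?_⟩
        exact (map_neg _ _).trans (congrArg (- ·) (h z hz hU)) }
  res := by
    intro U V i s hs c
    obtain ⟨g, hg, h⟩ := hs c
    exact ⟨g, hg.mono fun z hz => ⟨hz.1, hz.2.1, i hz.2.2⟩, fun z hz hV => h z hz (i hV)⟩
  loc := by
    classical
    intro U s H c
    refine ⟨fun z => if h : z ∈ c.preimage U then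
      c.evalResidue ⟨z, h.1⟩ h.2.1 (s ⟨_, h.2.2⟩) else 0, ?_, ?_⟩
    · rintro z ⟨h, hz, hU⟩
      obtain ⟨V, i, hV, hs⟩ := H ⟨_, hU⟩
      obtain ⟨g, hg, hgs⟩ := hs c
      have hn : c.preimage V ∈ nhds z := (c.isOpen_preimage V).mem_nhds ⟨h, hz, hV⟩
      refine ContDiffAt.contDiffWithinAt ?_
      refine ((hg z ⟨h, hz, hV⟩).contDiffAt hn).congr_of_eventuallyEq ?_
      filter_upwards [hn] with w hw
      rw [dif_pos ⟨hw.1, hw.2.1, i hw.2.2⟩, ← hgs ⟨w, hw.1⟩ hw.2.1 hw.2.2]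
    · intro z hz hU
      have h : z.1 ∈ c.preimage U := ⟨z.2, hz, hU⟩
      change _ = if h : z.1 ∈ c.preimage U then
        c.evalResidue ⟨z.1, h.1⟩ h.2.1 (s ⟨_, h.2.2⟩) else 0
      rw [dif_pos h]

theorem isSmoothFamily_evaluation {X : RealRingedSpace} {U : Opens X.toLRS}
    (f : X.toLRS.presheaf.obj (op U)) : IsSmoothFamily fun x : U => X.toLRS.evaluation x f := by
  intro c
  let f' : KleinPlane.sections.presheaf.obj (op (c.domain.isOpenEmbedding.isOpenMap.functor.obj
      ((Opens.map c.hom.base).obj U))) := c.hom.c.app (op U) f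
  obtain ⟨⟨g, hg, hgf⟩, -⟩ := f'.2
  refine ⟨g, ?_, fun z hz hU => ?_⟩
  · rw [c.preimage_eq]
    exact (hg.contDiffOn (KleinPlane.isOpen_lift _)).restrict_scalars ℝ
  · rw [c.evalResidue_evaluation]
    exact hgf _ _

/-- The sheaf `𝒞` of smooth functions on `X`, induced by the sheaf `(p_* C^∞)^Σ` of invariant smooth
functions on `ℍ`. -/
def smoothSheaf (X : RealRingedSpace) : TopCat.Sheaf CommRingCat.{0} X.toLRS.toTopCat :=
  ⟨(smoothSections X).presheaf, (smoothSections X).isSheaf⟩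

/-- The morphism `𝒪 ⟶ 𝒞` (on Klein surfaces, an inclusion), sending a section `f` to the family of
its values `(f(x))_x`. -/
def toSmooth (X : RealRingedSpace) : X.toLRS.sheaf ⟶ smoothSheaf X where
  hom :=
    { app := fun U => CommRingCat.ofHom (
        { toFun := fun f => ⟨fun x => X.toLRS.evaluation x f, isSmoothFamily_evaluation f⟩
          map_one' := Subtype.ext (funext fun _ => map_one _)
          map_mul' := fun _ _ => Subtype.ext (funext fun _ => map_mul _ _ _)
          map_zero' := Subtype.ext (funext fun _ => map_zero _)
          map_add' := fun _ _ => Subtype.ext (funext fun _ => map_add _ _ _) } :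
          X.toLRS.presheaf.obj U →+* (smoothSections X).ring U.unop)
      naturality := by
        intro U V i
        refine CommRingCat.hom_ext (RingHom.ext fun f => ?_)
        refine Subtype.ext (funext fun x => ?_)
        change X.toLRS.residue x.1 (X.toLRS.presheaf.germ V.unop x.1 x.2 (X.toLRS.presheaf.map i f))
          = X.toLRS.residue x.1 (X.toLRS.presheaf.germ U.unop x.1 (leOfHom i.unop x.2) f)
        exact congrArg _ (TopCat.Presheaf.germ_res_apply' _ i _ x.2 f) }

/-- A Klein surface: a locally ringed space `(S, 𝒪)`, with `𝒪` a sheaf of `ℝ`-algebras, which is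
compact, connected and Hausdorff and is locally isomorphic to `(ℍ, 𝒪)`. -/
structure KleinSurface extends RealRingedSpace where
  compactSpace : CompactSpace toLRS
  connectedSpace : ConnectedSpace toLRS
  t2Space : T2Space toLRS
  exists_chart : ∀ x : toLRS, ∃ c : KleinChart toRealRingedSpace, x ∈ Set.range c.hom.base

end Klein

end

/-! A smooth line bundle becomes holomorphic once it carries a `∂̄`-operator, and in complex
dimension one there is no integrability condition to satisfy. Choose local frames `e k` of `L'` over
opens `U k` and a smooth partition of unity `ρ k` subordinate to them, and average the operators
that kill the `e k`. If a frame `m` equals `a k • e k` on the overlap with `U k`, the averaged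
operator sends `m` to `α` times `m`, where `α = ∑ ρ k · ∂̄(a k) / a k` (`FramePartition.form`).
Multiplying `m` by an invertible smooth function `h` adds `∂̄h / h` to `α` (`form_smul`).

Call a frame parallel if `α = 0`. Parallel frames exist near every point: the `∂̄`-Poincaré lemma
(`exists_dbar_eq`, proved by convolution with `1/(πz)` and the Cauchy-Pompeiu formula) solves `∂̄u =
-α`, and `exp u` times the given frame is parallel (`exists_isParallel`). The ratio `h` of two
parallel frames satisfies `∂̄h = 0`, so it is locally a section of `𝒪`
(`exists_eq_onSections_smul`).

Hence parallel frames define a holomorphic structure: `L` is the subsheaf of `L'` of local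
`𝒪`-multiples of parallel frames (`FrameFamily.descent`). As `𝒪 → 𝒞` is injective, a parallel frame
is also a frame of `L`. So `𝒞(V) ⊗ L(V) → L'(V)` is bijective for all small `V`, and it becomes an
isomorphism after sheafification (`FrameFamily.nonempty_iso`).

The analysis takes place on `ℂ ∖ ℝ`, equivariantly for complex conjugation. A parameter over a point
embeds its residue field in `ℂ`, and the conjugate parameter gives the conjugate embedding. With the
right choice of parameters, changes of chart are holomorphic (`KleinChart.exists_transition`); then
`α` transforms like the coefficient of a `(0,1)`-form and commutes with conjugation, so parallelism
does not depend on the chart. Conjugation has no fixed points on `ℂ ∖ ℝ`, so a solution `u` on one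
side of the real axis can simply be reflected to the other. -/

open CategoryTheory TopologicalSpace Opposite AlgebraicGeometry
open scoped ContDiff TensorProduct

noncomputable section

namespace Klein

open DoubleHalfPlane

/-! ### Sections of sheaves of modules: restriction, gluing, frames. -/

section Descent

variable {X : TopCat.{0}} {R S : TopCat.Sheaf CommRingCat.{0} X}

/-- Restriction of sections of a sheaf of modules. -/
def res (M : SheafOfModules.{0} (ringSheaf S)) {U V : Opens X} (h : V ≤ U)
    (m : M.val.obj (op U)) : M.val.obj (op V) := M.val.map (homOfLE h).op m

/-- Restriction of sections of a sheaf of rings. -/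
def ringRes (S : TopCat.Sheaf CommRingCat.{0} X) {U V : Opens X} (h : V ≤ U) :
    (ringSheaf S).obj.obj (op U) →+* (ringSheaf S).obj.obj (op V) :=
  ((ringSheaf S).obj.map (homOfLE h).op).hom

/-- A morphism of sheaves of rings on sections. -/
def onSections (φ : R ⟶ S) (U : Opens X) :
    (ringSheaf R).obj.obj (op U) →+* (ringSheaf S).obj.obj (op U) :=
  (φ.hom.app (op U)).hom

theorem onSections_ringRes (φ : R ⟶ S) {U V : Opens X} (h : V ≤ U)
    (r : (ringSheaf R).obj.obj (op U)) :
    onSections φ V (ringRes R h r) = ringRes S h (onSections φ U r) :=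
  NatTrans.naturality_apply φ.hom (homOfLE h).op r

theorem ringRes_ringRes {U V W : Opens X} (h : V ≤ U) (h' : W ≤ V)
    (r : (ringSheaf S).obj.obj (op U)) :
    ringRes S h' (ringRes S h r) = ringRes S (h'.trans h) r := by
  have := (ringSheaf S).obj.map_comp (homOfLE h).op (homOfLE h').op
  exact (ConcreteCategory.congr_hom this r).symm

/-- `ringSheaf` takes values in `RingCat`; commutativity is recovered from the underlying sheaf of
commutative rings. -/
theorem sections_mul_comm {U : Opens X} (r s : (ringSheaf S).obj.obj (op U)) : r * s = s * r :=
  mul_comm (G := S.obj.obj (op U)) r s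

section

variable (M : SheafOfModules.{0} (ringSheaf S))

theorem res_smul {U V : Opens X} (h : V ≤ U) (r : (ringSheaf S).obj.obj (op U))
    (m : M.val.obj (op U)) : res M h (r • m) = ringRes S h r • res M h m :=
  M.val.map_smul _ r m

theorem res_add {U V : Opens X} (h : V ≤ U) (m m' : M.val.obj (op U)) :
    res M h (m + m') = res M h m + res M h m' :=
  map_add (M.val.map (homOfLE h).op).hom m m'

theorem res_zero {U V : Opens X} (h : V ≤ U) :
    res M h (0 : M.val.obj (op U)) = 0 :=
  map_zero (M.val.map (homOfLE h).op).hom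

theorem res_res {U V W : Opens X} (h : V ≤ U) (h' : W ≤ V) (m : M.val.obj (op U)) :
    res M h' (res M h m) = res M (h'.trans h) m :=
  (M.val.map_comp_apply (homOfLE h).op (homOfLE h').op m).symm

theorem res_self {U : Opens X} (m : M.val.obj (op U)) : res M le_rfl m = m := by
  have := ConcreteCategory.congr_hom (M.val.map_id (op U)) m
  exact this

/-- Sections of a sheaf of modules glue uniquely. -/
theorem existsUnique_gluing_res {ι : Type} (U : ι → Opens X) (V : Opens X) (hU : ∀ i, U i ≤ V)
    (hV : V ≤ iSup U) (s : ∀ i, M.val.obj (op (U i)))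
    (hs : ∀ i j, res M inf_le_left (s i) = res M (inf_le_right : U i ⊓ U j ≤ U j) (s j)) :
    ∃! t : M.val.obj (op V), ∀ i, res M (hU i) t = s i := by
  let F : TopCat.Sheaf AddCommGrpCat.{0} X := ⟨_, M.isSheaf⟩
  let s' : ∀ i, ToType (F.obj.obj (op (U i))) := s
  have h : TopCat.Presheaf.IsCompatible F.obj U s' := fun i j => hs i j
  exact F.existsUnique_gluing' U V (fun i => homOfLE (hU i)) hV s' h

/-- Sections of a sheaf of rings glue uniquely. -/
theorem existsUnique_gluing_ringRes {ι : Type} (U : ι → Opens X) (V : Opens X) (hU : ∀ i, U i ≤ V)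
    (hV : V ≤ iSup U) (s : ∀ i, (ringSheaf S).obj.obj (op (U i)))
    (hs : ∀ i j, ringRes S inf_le_left (s i) = ringRes S (inf_le_right : U i ⊓ U j ≤ U j) (s j)) :
    ∃! t : (ringSheaf S).obj.obj (op V), ∀ i, ringRes S (hU i) t = s i := by
  let s' : ∀ i, ToType (S.obj.obj (op (U i))) := s
  have h : TopCat.Presheaf.IsCompatible S.obj U s' := fun i j => hs i j
  exact S.existsUnique_gluing' U V (fun i => homOfLE (hU i)) hV s' h

/-- A section over `U` that trivializes a sheaf of modules over `U`. -/
def IsFrame {U : Opens X} (e : M.val.obj (op U)) : Prop :=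
  ∀ (V : Opens X) (h : V ≤ U),
    Function.Bijective fun r : (ringSheaf S).obj.obj (op V) =>
      (r • res M h e : M.val.obj (op V))

end

end Descent

/-! ### Descent of a sheaf of modules to a smaller sheaf of rings along compatible frames. -/

section Descent

variable {X : TopCat.{0}} {R S : TopCat.Sheaf CommRingCat.{0} X} (φ : R ⟶ S)
  (M : SheafOfModules.{0} (ringSheaf S))

theorem res_ext {V : Opens X} {m m' : M.val.obj (op V)}
    (h : ∀ x ∈ V, ∃ (W : Opens X) (hW : W ≤ V), x ∈ W ∧ res M hW m = res M hW m') : m = m' := by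
  choose W hW hx h using fun x : V => h x.1 x.2
  refine (existsUnique_gluing_res M W V hW (fun x hxV => Opens.mem_iSup.2 ⟨⟨x, hxV⟩, hx _⟩)
    (fun x => res M (hW x) m) ?_).unique (fun _ => rfl) (fun x => (h x).symm)
  intro x y
  rw [res_res, res_res]

/-- A family of local frames of a sheaf of `S`-modules `M` whose transition functions locally
come from `R`, along a morphism `φ : R ⟶ S` of sheaves of rings. -/
structure FrameFamily where
  ι : Type
  U : ι → Opens X
  e : ∀ i, M.val.obj (op (U i))
  exists_mem : ∀ x, ∃ i, x ∈ U i
  isFrame : ∀ i, IsFrame M (e i)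
  compat : ∀ (i j : ι) (x : X), x ∈ U i → x ∈ U j →
    ∃ (W : Opens X) (hi : W ≤ U i) (hj : W ≤ U j), x ∈ W ∧
      ∃ r : (ringSheaf R).obj.obj (op W), res M hj (e j) = onSections φ W r • res M hi (e i)

/-- The change of rings associated with a morphism of sheaves of rings. -/
def ringHom : (ringSheaf R).obj ⟶ (ringSheaf S).obj :=
  Functor.whiskerRight φ.hom (forget₂ CommRingCat RingCat)

namespace FrameFamily

variable {φ M} (F : FrameFamily φ M)

/-- A section of `M` is a local multiple of the frames if locally it is the product of one of the
frames and a section of `R`. -/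
def IsLocalMultiple {V : Opens X} (m : M.val.obj (op V)) : Prop :=
  ∀ x ∈ V, ∃ (i : F.ι) (W : Opens X) (hW : W ≤ V) (hi : W ≤ F.U i), x ∈ W ∧
    ∃ r : (ringSheaf R).obj.obj (op W), res M hW m = onSections φ W r • res M hi (F.e i)

variable {F}

namespace IsLocalMultiple

/-- Thanks to the compatibility of the frames, the index of the frame can be prescribed. This is
what makes sums of local multiples local multiples. -/
theorem exists_eq {V : Opens X} {m : M.val.obj (op V)} (hm : F.IsLocalMultiple m) {x : X}
    (hx : x ∈ V) {i : F.ι} (hi : x ∈ F.U i) :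
    ∃ (W : Opens X) (hW : W ≤ V) (hi : W ≤ F.U i), x ∈ W ∧
      ∃ r : (ringSheaf R).obj.obj (op W), res M hW m = onSections φ W r • res M hi (F.e i) := by
  obtain ⟨j, W, hW, hj, hxW, r, hr⟩ := hm x hx
  obtain ⟨W', hi', hj', hxW', r', hr'⟩ := F.compat i j x hi (hj hxW)
  refine ⟨W ⊓ W', inf_le_left.trans hW, inf_le_right.trans hi', ⟨hxW, hxW'⟩,
    ringRes R inf_le_left r * ringRes R inf_le_right r', ?_⟩
  have h1 := congrArg (res M (inf_le_left : W ⊓ W' ≤ W)) hr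
  have h2 := congrArg (res M (inf_le_right : W ⊓ W' ≤ W')) hr'
  rw [res_smul, res_res, res_res] at h1 h2
  rw [h1, h2, map_mul, onSections_ringRes, onSections_ringRes, mul_smul]

theorem zero {V : Opens X} : F.IsLocalMultiple (0 : M.val.obj (op V)) := by
  intro x hx
  obtain ⟨i, hi⟩ := F.exists_mem x
  refine ⟨i, V ⊓ F.U i, inf_le_left, inf_le_right, ⟨hx, hi⟩, 0, ?_⟩
  rw [map_zero, zero_smul, res_zero]

theorem add {V : Opens X} {m m' : M.val.obj (op V)} (hm : F.IsLocalMultiple m)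
    (hm' : F.IsLocalMultiple m') : F.IsLocalMultiple (m + m') := by
  intro x hx
  obtain ⟨i, W, hW, hi, hxW, r, hr⟩ := hm x hx
  obtain ⟨W', hW', hi', hxW', r', hr'⟩ := hm'.exists_eq hx (hi hxW)
  refine ⟨i, W ⊓ W', inf_le_left.trans hW, inf_le_left.trans hi, ⟨hxW, hxW'⟩,
    ringRes R inf_le_left r + ringRes R inf_le_right r', ?_⟩
  have h1 := congrArg (res M (inf_le_left : W ⊓ W' ≤ W)) hr
  have h2 := congrArg (res M (inf_le_right : W ⊓ W' ≤ W')) hr'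
  rw [res_smul, res_res, res_res] at h1 h2
  rw [res_add, h1, h2, map_add, onSections_ringRes, onSections_ringRes, add_smul]

theorem smul {V : Opens X} {m : M.val.obj (op V)} (hm : F.IsLocalMultiple m)
    (r : (ringSheaf R).obj.obj (op V)) : F.IsLocalMultiple (onSections φ V r • m) := by
  intro x hx
  obtain ⟨i, W, hW, hi, hxW, s, hs⟩ := hm x hx
  refine ⟨i, W, hW, hi, hxW, ringRes R hW r * s, ?_⟩
  rw [res_smul, hs, map_mul, onSections_ringRes, mul_smul]

theorem res {V V' : Opens X} (h : V' ≤ V) {m : M.val.obj (op V)} (hm : F.IsLocalMultiple m) :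
    F.IsLocalMultiple (res M h m) := by
  intro x hx
  obtain ⟨i, W, hW, hi, hxW, r, hr⟩ := hm x (h hx)
  refine ⟨i, W ⊓ V', inf_le_right, inf_le_left.trans hi, ⟨hxW, hx⟩, ringRes R inf_le_left r, ?_⟩
  have h1 := congrArg (Klein.res M (inf_le_left : W ⊓ V' ≤ W)) hr
  rw [res_smul, res_res, res_res] at h1
  rw [res_res, onSections_ringRes, h1]

end IsLocalMultiple

theorem isLocalMultiple_frame (i : F.ι) : F.IsLocalMultiple (F.e i) :=
  fun _ hx => ⟨i, F.U i, le_rfl, le_rfl, hx, 1, by rw [map_one, one_smul]⟩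

/-- This locality is the reason why sections of the subsheaf glued in `M` stay in the subsheaf. -/
theorem isLocalMultiple_of_locally {V : Opens X} {m : M.val.obj (op V)}
    (h : ∀ x ∈ V, ∃ (W : Opens X) (hW : W ≤ V), x ∈ W ∧ F.IsLocalMultiple (res M hW m)) :
    F.IsLocalMultiple m := by
  intro x hx
  obtain ⟨W, hW, hxW, hm⟩ := h x hx
  obtain ⟨i, W', hW', hi, hxW', r, hr⟩ := hm x hxW
  exact ⟨i, W', hW'.trans hW, hi, hxW', r, by rw [← hr, res_res]⟩

/-- Over an open subset of the domain of a frame, the local multiples of the frames are the multiples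
of this frame. -/
theorem IsLocalMultiple.exists_eq_smul
    (hφ : ∀ V, Function.Injective (onSections φ V)) {V : Opens X} {m : M.val.obj (op V)}
    (hm : F.IsLocalMultiple m) {i : F.ι} (hi : V ≤ F.U i) :
    ∃ r : (ringSheaf R).obj.obj (op V), m = onSections φ V r • Klein.res M hi (F.e i) := by
  choose W hW hWi hx r hr using fun x : V => hm.exists_eq x.2 (hi x.2)
  -- The local coefficients agree on overlaps: they yield the same multiple of the frame `F.e i`,
  -- and `φ` is injective. So they glue.
  have hc : ∀ x y, ringRes R inf_le_left (r x) =
      ringRes R (inf_le_right : W x ⊓ W y ≤ W y) (r y) := by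
    intro x y
    apply hφ
    apply (F.isFrame i (W x ⊓ W y) (inf_le_left.trans (hWi x))).1
    have h1 := congrArg (Klein.res M (inf_le_left : W x ⊓ W y ≤ W x)) (hr x)
    have h2 := congrArg (Klein.res M (inf_le_right : W x ⊓ W y ≤ W y)) (hr y)
    rw [res_smul, res_res, res_res] at h1 h2
    dsimp only
    rw [onSections_ringRes, onSections_ringRes, ← h1, h2]
  obtain ⟨t, ht, -⟩ := existsUnique_gluing_ringRes W V hW
    (fun x hxV => Opens.mem_iSup.2 ⟨⟨x, hxV⟩, hx _⟩) r hc
  refine ⟨t, res_ext M fun x hxV => ⟨W ⟨x, hxV⟩, hW _, hx _, ?_⟩⟩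
  rw [hr, res_smul, res_res, ← onSections_ringRes, ht]

variable (F)

/-- The presheaf of `R`-modules of local multiples of the frames, as a submodule of `M`. -/
def localMultiples : ((PresheafOfModules.restrictScalars (ringHom φ)).obj M.val).Submodule where
  obj V :=
    { carrier := {m | F.IsLocalMultiple (V := V.unop) m}
      add_mem' := fun hm hm' => IsLocalMultiple.add hm hm'
      zero_mem' := IsLocalMultiple.zero
      smul_mem' := fun r _ hm => IsLocalMultiple.smul hm r }
  map f _ hm := IsLocalMultiple.res (leOfHom f.unop) hm

/-- The sheaf of `R`-modules of local multiples of the frames. -/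
def descent : SheafOfModules.{0} (ringSheaf R) where
  val := F.localMultiples.toPresheafOfModules
  isSheaf := by
    refine (TopCat.Presheaf.isSheaf_iff_isSheafUniqueGluing
      (F := F.localMultiples.toPresheafOfModules.presheaf)).2 ?_
    intro κ U sf hsf
    let s : ∀ i, F.localMultiples.obj (op (U i)) := sf
    obtain ⟨t, ht, htu⟩ := existsUnique_gluing_res M U (iSup U) (le_iSup U) le_rfl
      (fun i => (s i).1) (fun i j => congrArg Subtype.val (hsf i j))
    have hmem : F.IsLocalMultiple t := by
      refine isLocalMultiple_of_locally fun x hx => ?_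
      obtain ⟨i, hi⟩ := Opens.mem_iSup.1 hx
      exact ⟨U i, le_iSup U i, hi, (ht i).symm ▸ (s i).2⟩
    refine ⟨(⟨t, hmem⟩ : F.localMultiples.obj (op (iSup U))), fun i => Subtype.ext (ht i), ?_⟩
    intro t' ht'
    exact Subtype.ext (htu _ fun i => congrArg Subtype.val (ht' i))

/-- A frame of `M` as a section of the sheaf of local multiples. -/
def frame (i : F.ι) : F.descent.val.obj (op (F.U i)) :=
  (⟨F.e i, F.isLocalMultiple_frame i⟩ : F.localMultiples.obj (op (F.U i)))

/-- Injectivity comes from the frame of `M` and from the injectivity of `φ`. Surjectivity is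
`IsLocalMultiple.exists_eq_smul`. -/
theorem isFrame_frame (hφ : ∀ V, Function.Injective (onSections φ V)) (i : F.ι) :
    IsFrame F.descent (F.frame i) := by
  refine fun V h => ⟨fun r r' hr => ?_, fun m => ?_⟩
  · exact hφ V ((F.isFrame i V h).1 (congrArg Subtype.val hr))
  · obtain ⟨r, hr⟩ := IsLocalMultiple.exists_eq_smul hφ m.2 h
    exact ⟨r, Subtype.ext hr.symm⟩

theorem isInvertibleSheaf_descent (hφ : ∀ V, Function.Injective (onSections φ V)) :
    IsInvertibleSheaf F.descent := by
  intro x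
  obtain ⟨i, hi⟩ := F.exists_mem x
  exact ⟨F.U i, hi, F.frame i, F.isFrame_frame hφ i⟩

end FrameFamily

end Descent

/-! ### Extension of scalars of a free module of rank one. -/

section ExtendScalars

/-- The linear map `B ⊗[A] N → P`, `b ⊗ n ↦ b • g n`, for a map `g : N → P` which is semilinear. -/
def extendLift {A B : Type} [CommRing A] [CommRing B] [Algebra A B] {N P : Type} [AddCommGroup N]
    [Module A N] [AddCommGroup P] [Module B P] (g : N →ₛₗ[algebraMap A B] P) :
    B ⊗[A] N →ₗ[B] P :=
  let G : B ⊗[A] N →+ P := TensorProduct.liftAddHom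
    { toFun := fun b =>
        { toFun := fun n => b • g n
          map_zero' := by rw [map_zero, smul_zero]
          map_add' := fun m n => by rw [map_add, smul_add] }
      map_zero' := by ext n; simp
      map_add' := fun s t => by ext n; simp [add_smul] }
    (fun r s n => by
      change (r • s) • g n = s • g (r • n)
      rw [LinearMap.map_smulₛₗ, Algebra.smul_def, smul_smul, mul_comm])
  { toFun := G
    map_add' := G.map_add
    map_smul' := fun t x => by
      induction x using TensorProduct.induction_on with
      | zero => rw [smul_zero, map_zero, smul_zero]
      | add x y hx hy => rw [smul_add, map_add, map_add, smul_add, hx, hy]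
      | tmul s m => simp [G, TensorProduct.smul_tmul', mul_smul] }

/-- Since `n` generates `N`, every tensor has the form `b ⊗ n`, and on these the map is `b ↦ b • g
n`. -/
theorem extendLift_bijective {A B : Type} [CommRing A] [CommRing B] [Algebra A B] {N P : Type}
    [AddCommGroup N] [Module A N] [AddCommGroup P] [Module B P] (g : N →ₛₗ[algebraMap A B] P)
    (n : N) (hn : Function.Surjective fun a : A => a • n)
    (hb : Function.Bijective fun b : B => b • g n) : Function.Bijective (extendLift g) := by
  have h : ∀ x : B ⊗[A] N, ∃ b : B, x = b ⊗ₜ n := by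
    intro x
    induction x using TensorProduct.induction_on with
    | zero => exact ⟨0, (TensorProduct.zero_tmul _ _).symm⟩
    | add x y hx hy =>
      obtain ⟨b, rfl⟩ := hx
      obtain ⟨c, rfl⟩ := hy
      exact ⟨b + c, (TensorProduct.add_tmul _ _ _).symm⟩
    | tmul b m =>
      obtain ⟨a, rfl⟩ := hn m
      exact ⟨a • b, (TensorProduct.smul_tmul _ _ _).symm⟩
  constructor
  · intro x y hxy
    obtain ⟨b, rfl⟩ := h x
    obtain ⟨c, rfl⟩ := h y
    rw [show b = c from hb.1 hxy]
  · intro p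
    obtain ⟨b, rfl⟩ := hb.2 p
    exact ⟨b ⊗ₜ n, rfl⟩

end ExtendScalars

/-! ### Comparison of the extended sheaf of local multiples with the original sheaf. -/

section Descent

variable {X : TopCat.{0}} {R S : TopCat.Sheaf CommRingCat.{0} X} {φ : R ⟶ S}
  {M : SheafOfModules.{0} (ringSheaf S)}

namespace FrameFamily

variable (F : FrameFamily φ M)

/-- The same module structure, seen over the commutative ring `R.obj.obj V`, over which tensor
products are formed. -/
instance (M : SheafOfModules.{0} (ringSheaf R)) (V : (Opens X)ᵒᵖ) :
    Module (R.obj.obj V) (M.val.obj V) := (M.val.obj V).isModule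

/-- The inclusion of the local multiples, as a semilinear map. -/
def inclusion (V : (Opens X)ᵒᵖ) :
    letI := (φ.hom.app V).hom.toAlgebra
    F.descent.val.obj V →ₛₗ[algebraMap (R.obj.obj V) (S.obj.obj V)] M.val.obj V :=
  letI := (φ.hom.app V).hom.toAlgebra
  { toFun := fun m => Subtype.val (p := (· ∈ F.localMultiples.obj V)) m
    map_add' := fun _ _ => rfl
    map_smul' := fun _ _ => rfl }

/-- The map `S(V) ⊗ L(V) → M(V)` for the sheaf `L` of local multiples. -/
def extendMap (V : (Opens X)ᵒᵖ) :
    letI := (φ.hom.app V).hom.toAlgebra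
    (S.obj.obj V ⊗[R.obj.obj V] F.descent.val.obj V) →ₗ[S.obj.obj V] M.val.obj V :=
  letI := (φ.hom.app V).hom.toAlgebra
  extendLift (F.inclusion V)

theorem extendMap_restrict {V W : (Opens X)ᵒᵖ} (f : V ⟶ W) :
    letI := (φ.hom.app V).hom.toAlgebra
    letI := (φ.hom.app W).hom.toAlgebra
    ∀ x : S.obj.obj V ⊗[R.obj.obj V] F.descent.val.obj V,
      F.extendMap W (tensorRestrict φ.hom F.descent.val f x) = M.val.map f (F.extendMap V x) := by
  let := (φ.hom.app V).hom.toAlgebra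
  let := (φ.hom.app W).hom.toAlgebra
  intro x
  induction x using TensorProduct.induction_on with
  | zero =>
    rw [map_zero, map_zero, map_zero]
    exact (map_zero (M.val.map f).hom).symm
  | add x y hx hy =>
    rw [map_add, map_add, map_add, hx, hy]
    exact (map_add (M.val.map f).hom _ _).symm
  | tmul s m => exact (M.val.map_smul f s _).symm

/-- The canonical morphism from the presheaf tensor product to `M`. -/
def extendHom : @Quiver.Hom (PresheafOfModules.{0} (ringSheaf S).obj) _
    (presheafExtendScalars φ.hom F.descent.val)
    ((PresheafOfModules.restrictScalars (𝟙 (ringSheaf S).obj)).obj M.val) where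
  app V :=
    let Y : ModuleCat ((S.obj ⋙ forget₂ CommRingCat RingCat).obj V) :=
      ((PresheafOfModules.restrictScalars (𝟙 (ringSheaf S).obj)).obj M.val).obj V
    ModuleCat.ofHom (X := tensorObj φ.hom F.descent.val V) (Y := Y)
      { toFun := F.extendMap V
        map_add' := (F.extendMap V).map_add
        map_smul' := (F.extendMap V).map_smul }
  naturality := by
    intro V W f
    refine ModuleCat.hom_ext (LinearMap.ext fun x => ?_)
    exact F.extendMap_restrict f x

theorem extendMap_bijective (hφ : ∀ V, Function.Injective (onSections φ V)) (i : F.ι) (V : Opens X)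
    (hi : V ≤ F.U i) : Function.Bijective (F.extendMap (op V)) := by
  let := (φ.hom.app (op V)).hom.toAlgebra
  exact extendLift_bijective (F.inclusion (op V)) (res F.descent hi (F.frame i))
    ((F.isFrame_frame hφ i) V hi).2 (F.isFrame i V hi)

/-- `L ⊗ S ≅ M` for the sheaf `L` of local multiples. -/
theorem nonempty_iso (hφ : ∀ V, Function.Injective (onSections φ V)) :
    Nonempty (sheafExtendScalars φ F.descent ≅ M) := by
  let f := (PresheafOfModules.toPresheaf (ringSheaf S).obj).map F.extendHom
  have h1 : Presheaf.IsLocallyInjective (Opens.grothendieckTopology X) f := by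
    constructor
    intro V x y hxy p hp
    obtain ⟨i, hi⟩ := F.exists_mem p
    refine ⟨V.unop ⊓ F.U i, homOfLE inf_le_left, ?_, ⟨hp, hi⟩⟩
    apply (F.extendMap_bijective hφ i (V.unop ⊓ F.U i) inf_le_right).1
    have hxy' : F.extendMap V x = F.extendMap V y := hxy
    have h := congrArg (M.val.map (homOfLE (inf_le_left : V.unop ⊓ F.U i ≤ V.unop)).op) hxy'
    have hx := F.extendMap_restrict (homOfLE (inf_le_left : V.unop ⊓ F.U i ≤ V.unop)).op x
    have hy := F.extendMap_restrict (homOfLE (inf_le_left : V.unop ⊓ F.U i ≤ V.unop)).op y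
    exact hx.trans (h.trans hy.symm)
  have h2 : Presheaf.IsLocallySurjective (Opens.grothendieckTopology X) f := by
    constructor
    intro V m p hp
    obtain ⟨i, hi⟩ := F.exists_mem p
    refine ⟨V ⊓ F.U i, homOfLE inf_le_left, ?_, ⟨hp, hi⟩⟩
    obtain ⟨t, ht⟩ := (F.extendMap_bijective hφ i (V ⊓ F.U i) inf_le_right).2
      (M.val.map (homOfLE (inf_le_left : V ⊓ F.U i ≤ V)).op m)
    exact ⟨t, ht⟩
  -- Sheafification inverts locally bijective morphisms of presheaves of abelian groups; `h3`
  -- transfers this to presheaves of modules.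
  have hW : (Opens.grothendieckTopology X).W f :=
    GrothendieckTopology.W_of_isLocallyBijective _ f
  have h3 := PresheafOfModules.inverseImage_W_toPresheaf_eq_inverseImage_isomorphisms
      (𝟙 (ringSheaf S).obj)
  have h4 : ((Opens.grothendieckTopology X).W.inverseImage
    (PresheafOfModules.toPresheaf (ringSheaf S).obj)) F.extendHom := hW
  rw [h3] at h4
  have h5 : IsIso ((PresheafOfModules.sheafification (𝟙 (ringSheaf S).obj)).map F.extendHom) := h4
  -- `M` is already a sheaf, so it is its own sheafification.
  have h6 : IsIso ((PresheafOfModules.sheafificationAdjunction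
    (𝟙 (ringSheaf S).obj)).counit.app M) := inferInstance
  exact ⟨@asIso _ _ _ _ _ h5 ≪≫ @asIso _ _ _ _ _ h6⟩

end FrameFamily

end Descent

/-- The sheaf-theoretic half of the argument: what remains is to find local frames whose transition
functions are sections of `R`. -/
theorem FrameFamily.exists_isInvertibleSheaf {X : TopCat.{0}} {R S : TopCat.Sheaf CommRingCat.{0} X}
    {φ : R ⟶ S} {M : SheafOfModules.{0} (ringSheaf S)} (F : FrameFamily φ M)
    (hφ : ∀ V, Function.Injective (onSections φ V)) :
    ∃ L : SheafOfModules.{0} (ringSheaf R),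
      IsInvertibleSheaf L ∧ Nonempty (sheafExtendScalars φ L ≅ M) :=
  ⟨F.descent, F.isInvertibleSheaf_descent hφ, F.nonempty_iso hφ⟩

/-! ### Calculus of the Cauchy-Riemann operator. -/

section Dbar

open Complex Filter Topology

/-- The Cauchy-Riemann operator `∂/∂z̄`. -/
def dbar (g : ℂ → ℂ) (z : ℂ) : ℂ := (fderiv ℝ g z 1 + I * fderiv ℝ g z I) / 2

theorem dbar_congr {f g : ℂ → ℂ} {z : ℂ} (h : f =ᶠ[𝓝 z] g) : dbar f z = dbar g z := by
  rw [dbar, dbar, h.fderiv_eq]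

theorem differentiableAt_iff_dbar {g : ℂ → ℂ} {z : ℂ} :
    DifferentiableAt ℂ g z ↔ DifferentiableAt ℝ g z ∧ dbar g z = 0 := by
  rw [differentiableAt_complex_iff_differentiableAt_real]
  refine and_congr_right fun _ => ⟨fun h => ?_, fun h => ?_⟩
  · rw [dbar, h, smul_eq_mul, ← mul_assoc, I_mul_I]
    ring
  · have h1 : fderiv ℝ g z 1 + I * fderiv ℝ g z I = 0 := by
      simpa [dbar] using h
    rw [smul_eq_mul]
    linear_combination (-I) * h1 + fderiv ℝ g z I * I_mul_I

theorem dbar_mul {f g : ℂ → ℂ} {z : ℂ} (hf : DifferentiableAt ℝ f z)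
    (hg : DifferentiableAt ℝ g z) : dbar (fun w => f w * g w) z = dbar f z * g z + f z * dbar g z := by
  simp only [dbar, fderiv_fun_mul hf hg, add_apply,
    smul_apply, smul_eq_mul]
  ring

theorem dbar_exp {u : ℂ → ℂ} {z : ℂ} (hu : DifferentiableAt ℝ u z) :
    dbar (fun w => exp (u w)) z = exp (u z) * dbar u z := by
  have h : HasFDerivAt (fun w => exp (u w)) (exp (u z) • fderiv ℝ u z) z :=
    hu.hasFDerivAt.cexp
  simp only [dbar, h.fderiv, smul_apply, smul_eq_mul]
  ring

theorem fderiv_apply_eq (ℓ : ℂ →L[ℝ] ℂ) (w : ℂ) : ℓ w = w.re * ℓ 1 + w.im * ℓ I := by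
  have h : w = w.re • (1 : ℂ) + w.im • I := by simp
  conv_lhs => rw [h]
  rw [map_add, map_smul, map_smul, real_smul, real_smul]

/-- The differential of `φ` is complex linear, so only `∂̄g` contributes. The conjugate of the
derivative is the factor by which coefficients of `dz̄` transform. -/
theorem dbar_comp {g φ : ℂ → ℂ} {z : ℂ} (hφ : DifferentiableAt ℂ φ z)
    (hg : DifferentiableAt ℝ g (φ z)) :
    dbar (fun w => g (φ w)) z = starRingEnd ℂ (deriv φ z) * dbar g (φ z) := by
  have h := hg.hasFDerivAt.comp z (hφ.hasDerivAt.hasFDerivAt.restrictScalars ℝ)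
  have h' : fderiv ℝ (fun w => g (φ w)) z = _ := h.fderiv
  simp only [dbar, h', ContinuousLinearMap.comp_apply, ContinuousLinearMap.coe_restrictScalars',
    ContinuousLinearMap.toSpanSingleton_apply, smul_eq_mul, one_mul]
  rw [fderiv_apply_eq _ (deriv φ z), fderiv_apply_eq _ (I * deriv φ z)]
  have h2 : starRingEnd ℂ (deriv φ z) = (deriv φ z).re - (deriv φ z).im * I := by
    apply Complex.ext <;> simp
  rw [h2]
  simp only [I_mul_re, I_mul_im, ofReal_neg]
  linear_combination (((deriv φ z).im : ℂ) * fderiv ℝ g (φ z) I / 2) * I_mul_I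

theorem dbar_conj {g : ℂ → ℂ} {z : ℂ} (hg : DifferentiableAt ℝ g (starRingEnd ℂ z)) :
    dbar (fun w => starRingEnd ℂ (g (starRingEnd ℂ w))) z =
      starRingEnd ℂ (dbar g (starRingEnd ℂ z)) := by
  have h1 : HasFDerivAt (starRingEnd ℂ) (conjCLE : ℂ →L[ℝ] ℂ) z := conjCLE.hasFDerivAt
  have h2 : HasFDerivAt (starRingEnd ℂ) (conjCLE : ℂ →L[ℝ] ℂ) (g (starRingEnd ℂ z)) :=
    conjCLE.hasFDerivAt
  have h : fderiv ℝ (fun w => starRingEnd ℂ (g (starRingEnd ℂ w))) z = _ :=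
    (h2.comp z (hg.hasFDerivAt.comp z h1)).fderiv
  simp only [dbar, h, map_div₀, map_add, map_mul, map_ofNat]
  simp

theorem contDiffOn_dbar {g : ℂ → ℂ} {s : Set ℂ} (hs : IsOpen s) (hg : ContDiffOn ℝ ∞ g s) :
    ContDiffOn ℝ ∞ (dbar g) s := by
  have h : ContDiffOn ℝ ∞ (fderiv ℝ g) s := hg.fderiv_of_isOpen hs le_rfl
  have h1 (v : ℂ) : ContDiffOn ℝ ∞ (fun z => fderiv ℝ g z v) s := h.clm_apply contDiffOn_const
  exact ((h1 1).add (contDiffOn_const.mul (h1 I))).div_const 2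

end Dbar

/-! ### The Cauchy-Pompeiu formula and the `∂̄`-Poincaré lemma. -/

section Poincare

open Complex Filter Topology MeasureTheory Set
open scoped Convolution Real

theorem continuous_fderiv_apply_comp {χ : ℂ → ℂ} (hχ : ContDiff ℝ 1 χ) {α : Type*}
    [TopologicalSpace α] {f v : α → ℂ} (hf : Continuous f) (hv : Continuous v) :
    Continuous fun p => fderiv ℝ χ (f p) (v p) :=
  ((hχ.continuous_fderiv one_ne_zero).comp hf).clm_apply hv

/-- The fundamental theorem of calculus along the ray through `v`; compact support removes the
boundary term at infinity. -/
theorem integral_polar_radial {χ : ℂ → ℂ} (hχ : ContDiff ℝ 1 χ) (hc : HasCompactSupport χ) (v : ℂ)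
    (hv : v ≠ 0) : ∫ r in Ioi (0 : ℝ), fderiv ℝ χ (r * v) v = -χ 0 := by
  have hd : ∀ r : ℝ, HasDerivAt (fun r : ℝ => χ (r * v)) (fderiv ℝ χ (r * v) v) r := by
    intro r
    have h1 : HasDerivAt (fun r : ℝ => (r : ℂ) * v) v r := by
      simpa using (hasDerivAt_id (r : ℂ)).comp_ofReal.mul_const v
    exact ((hχ.differentiable one_ne_zero) _).hasFDerivAt.comp_hasDerivAt r h1
  have h2 : ContDiff ℝ 1 (fun r : ℝ => χ (r * v)) :=
    hχ.comp ((ofRealCLM.contDiff).mul contDiff_const)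
  have h3 : HasCompactSupport (fun r : ℝ => χ (r * v)) := by
    refine hc.comp_isClosedEmbedding ?_
    have h5 : Topology.IsClosedEmbedding fun r : ℝ => r • v := isClosedEmbedding_smul_left hv
    simpa only [real_smul] using h5
  have h4 := h3.integral_Ioi_deriv_eq h2 0
  rw [show deriv (fun r : ℝ => χ (r * v)) = fun r : ℝ => fderiv ℝ χ (r * v) v from
    funext fun r => (hd r).deriv] at h4
  simpa using h4

/-- The integrand is the `θ`-derivative of `r⁻¹ χ (r exp (iθ))`, which takes the same value at `-π`
and `π`. -/
theorem integral_polar_angular {χ : ℂ → ℂ} (hχ : ContDiff ℝ 1 χ) (r : ℝ) (hr : r ≠ 0) :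
    ∫ θ in Ioo (-π) π, fderiv ℝ χ (r * exp (θ * I)) (exp (θ * I) * I) = 0 := by
  have hd : ∀ θ : ℝ, HasDerivAt (fun θ : ℝ => (r : ℂ)⁻¹ * χ (r * exp (θ * I)))
      (fderiv ℝ χ (r * exp (θ * I)) (exp (θ * I) * I)) θ := by
    intro θ
    have h1 : HasDerivAt (fun θ : ℝ => (r : ℂ) * exp (θ * I)) (r • (exp (θ * I) * I)) θ := by
      have := (((hasDerivAt_id (θ : ℂ)).mul_const I).cexp.const_mul (r : ℂ)).comp_ofReal
      simpa using this
    have h2 := (((hχ.differentiable one_ne_zero) _).hasFDerivAt.comp_hasDerivAt θ h1).const_mul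
      (r : ℂ)⁻¹
    rw [map_smul, real_smul, inv_mul_cancel_left₀ (ofReal_ne_zero.2 hr)] at h2
    exact h2
  rw [← integral_Ioc_eq_integral_Ioo, ← intervalIntegral.integral_of_le (by linarith [Real.pi_pos]),
    intervalIntegral.integral_eq_sub_of_hasDerivAt (fun θ _ => hd θ)]
  · have : exp ((π : ℝ) * I) = exp ((-π : ℝ) * I) := by
      rw [exp_pi_mul_I, ofReal_neg, neg_mul, exp_neg_pi_mul_I]
    rw [this, sub_self]
  · refine (Continuous.intervalIntegrable ?_ _ _)
    exact continuous_fderiv_apply_comp hχ (by fun_prop) (by fun_prop)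

/-- The Cauchy-Pompeiu formula for functions with compact support. -/
theorem integral_inv_mul_dbar {χ : ℂ → ℂ} (hχ : ContDiff ℝ 1 χ) (hc : HasCompactSupport χ) :
    ∫ w : ℂ, w⁻¹ * dbar χ w = -π * χ 0 := by
  rw [← Complex.integral_comp_polarCoord_symm]
  -- The polar Jacobian `r` cancels the pole of `w⁻¹`. What is left is half the radial derivative
  -- `F` plus `I / 2` times the derivative `G` in the unit tangential direction.
  let F (p : ℝ × ℝ) : ℂ := fderiv ℝ χ (p.1 * exp (p.2 * I)) (exp (p.2 * I))
  let G (p : ℝ × ℝ) : ℂ := fderiv ℝ χ (p.1 * exp (p.2 * I)) (exp (p.2 * I) * I)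
  have h1 : ∀ p ∈ polarCoord.target, p.1 • ((Complex.polarCoord.symm p)⁻¹ *
      dbar χ (Complex.polarCoord.symm p)) = (1 / 2 : ℂ) * F p + (I / 2) * G p := by
    rintro ⟨r, θ⟩ ⟨hr, hθ⟩
    have hr' : (r : ℂ) ≠ 0 := ofReal_ne_zero.2 (ne_of_gt hr)
    have h2 : Complex.polarCoord.symm (r, θ) = r * exp (θ * I) := by
      rw [Complex.polarCoord_symm_apply, exp_mul_I, ofReal_cos, ofReal_sin]
    rw [h2, mul_inv, real_smul]
    dsimp only [F, G]
    rw [fderiv_apply_eq _ (exp (θ * I)), fderiv_apply_eq _ (exp (θ * I) * I), ← exp_neg, ← neg_mul,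
      dbar, mul_I_re, mul_I_im, exp_ofReal_mul_I_re, exp_ofReal_mul_I_im]
    have h3 : exp (-(θ : ℂ) * I) = Real.cos θ - Real.sin θ * I := by
      rw [exp_mul_I, cos_neg, sin_neg, ofReal_cos, ofReal_sin]; ring
    rw [h3]
    generalize fderiv ℝ χ (r * exp (θ * I)) = ℓ
    field_simp
    push_cast
    linear_combination (-(sin (θ : ℂ)) * ℓ I) * I_mul_I
  rw [setIntegral_congr_fun polarCoord.open_target.measurableSet h1]
  have hF : Continuous F := continuous_fderiv_apply_comp hχ (by fun_prop) (by fun_prop)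
  have hG : Continuous G := continuous_fderiv_apply_comp hχ (by fun_prop) (by fun_prop)
  -- Beyond the radius `ρ` both integrands vanish, so integrability on the unbounded strip reduces
  -- to a compact rectangle.
  obtain ⟨ρ, hρ⟩ : ∃ ρ : ℝ, ∀ w : ℂ, ρ < ‖w‖ → fderiv ℝ χ w = 0 := by
    obtain ⟨ρ, hρ⟩ := (hc.fderiv ℝ).isCompact.isBounded.exists_norm_le
    exact ⟨ρ, fun w hw => image_eq_zero_of_notMem_tsupport fun h => absurd (hρ w h) (not_le.2 hw)⟩
  have hint : ∀ H : ℝ × ℝ → ℂ, Continuous H → (∀ p : ℝ × ℝ, ρ < |p.1| → H p = 0) →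
      IntegrableOn H (Ioi (0 : ℝ) ×ˢ Ioo (-π) π) := by
    intro H hH h0
    have : IntegrableOn H (Icc 0 ρ ×ˢ Icc (-π) π) :=
      hH.continuousOn.integrableOn_compact (isCompact_Icc.prod isCompact_Icc)
    refine this.of_forall_sdiff_eq_zero (measurableSet_Ioi.prod measurableSet_Ioo) ?_
    rintro ⟨r, θ⟩ ⟨⟨hr, hθ⟩, h⟩
    refine h0 _ ?_
    by_contra h'
    refine h ⟨⟨le_of_lt hr, ?_⟩, Ioo_subset_Icc_self hθ⟩
    rw [not_lt] at h'
    exact (le_abs_self r).trans h'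
  have hFi : IntegrableOn F (Ioi (0 : ℝ) ×ˢ Ioo (-π) π) := hint F hF fun p hp => by
    dsimp only [F]
    rw [hρ _ (by simpa using hp)]; rfl
  have hGi : IntegrableOn G (Ioi (0 : ℝ) ×ˢ Ioo (-π) π) := hint G hG fun p hp => by
    dsimp only [G]
    rw [hρ _ (by simpa using hp)]; rfl
  have htarget : polarCoord.target = Ioi (0 : ℝ) ×ˢ Ioo (-π) π := rfl
  rw [htarget, integral_add (hFi.const_mul _) (hGi.const_mul _), integral_const_mul,
    integral_const_mul]
  have h3 : ∫ p in Ioi (0 : ℝ) ×ˢ Ioo (-π) π, G p = 0 := by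
    rw [Measure.volume_eq_prod, setIntegral_prod _ hGi]
    refine (setIntegral_congr_fun measurableSet_Ioi fun r hr => ?_).trans (integral_zero _ _)
    exact integral_polar_angular hχ r (ne_of_gt hr)
  -- The order of integration is swapped to integrate along rays first; each ray contributes `-χ 0`,
  -- and the angles have total length `2π`.
  have h4 : ∫ p in Ioi (0 : ℝ) ×ˢ Ioo (-π) π, F p = -(2 * π) * χ 0 := by
    rw [Measure.volume_eq_prod, ← setIntegral_prod_swap, setIntegral_prod (fun p => F p.swap) hFi.swap]
    have : ∀ θ ∈ Ioo (-π) π, ∫ r in Ioi (0 : ℝ), F (r, θ) = -χ 0 := fun θ _ =>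
      integral_polar_radial hχ hc (exp (θ * I)) (exp_ne_zero _)
    refine (setIntegral_congr_fun measurableSet_Ioo this).trans ?_
    rw [setIntegral_const]
    rw [Real.volume_real_Ioo_of_le (by linarith [Real.pi_pos]), real_smul]
    push_cast
    ring
  rw [h3, h4]
  ring

/-- The order of the pole, one, is less than the real dimension two. -/
theorem locallyIntegrable_inv : LocallyIntegrable (fun w : ℂ => w⁻¹) := by
  refine locallyIntegrable_of_norm_le_rpow (C := 1) (α := 1) ?_ ?_ ?_ ?_
  · simp
  · simp
  · refine Eventually.of_forall fun w => ?_
    rw [norm_inv, Real.rpow_neg_one, one_mul]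
  · exact measurable_inv.aestronglyMeasurable

/-- The `∂̄`-Poincaré lemma for functions with compact support. -/
theorem exists_dbar_eq_of_hasCompactSupport {ψ : ℂ → ℂ} (hψ : ContDiff ℝ ∞ ψ)
    (hc : HasCompactSupport ψ) : ∃ u : ℂ → ℂ, ContDiff ℝ ∞ u ∧ ∀ z, dbar u z = ψ z := by
  let L := ContinuousLinearMap.mul ℝ ℂ
  -- Up to the factor `π⁻¹`, `w⁻¹` is the fundamental solution of `∂̄`. Derivatives of the
  -- convolution fall on the smooth factor `ψ`.
  let u₀ : ℂ → ℂ := (fun w : ℂ => w⁻¹) ⋆[L] ψ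
  have h1 : ContDiff ℝ ∞ u₀ := hc.contDiff_convolution_right L locallyIntegrable_inv hψ
  have hψ1 : ContDiff ℝ 1 ψ := hψ.of_le (by exact_mod_cast le_top)
  have h2 : ∀ z v, fderiv ℝ u₀ z v = ∫ w : ℂ, w⁻¹ * fderiv ℝ ψ (z - w) v := by
    intro z v
    rw [(hc.hasFDerivAt_convolution_right L locallyIntegrable_inv hψ1 z).fderiv,
      convolution_precompR_apply L locallyIntegrable_inv (hc.fderiv ℝ)
        (hψ1.continuous_fderiv one_ne_zero)]
    rfl
  refine ⟨fun z => (π : ℂ)⁻¹ * u₀ z, contDiff_const.mul h1, fun z => ?_⟩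
  have hχ : ContDiff ℝ 1 fun w => ψ (z - w) := hψ1.comp (contDiff_const.sub contDiff_id)
  have hχc : HasCompactSupport fun w => ψ (z - w) :=
    hc.comp_homeomorph (Homeomorph.subLeft z)
  have h3 : ∀ w v, fderiv ℝ (fun w => ψ (z - w)) w v = -fderiv ℝ ψ (z - w) v := by
    intro w v
    have h4 : HasFDerivAt (fun w => z - w) (-ContinuousLinearMap.id ℝ ℂ) w :=
      (hasFDerivAt_id w).const_sub z
    have h5 := ((hψ1.differentiable one_ne_zero) (z - w)).hasFDerivAt.comp w h4
    have h6 : fderiv ℝ (fun w => ψ (z - w)) w = _ := h5.fderiv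
    simp [h6]
  -- Cauchy-Pompeiu for `w ↦ ψ (z - w)`, whose value at `0` is `ψ z`. The reflection changes the
  -- sign of `∂̄`, which cancels the sign in the formula.
  have h4 := integral_inv_mul_dbar hχ hχc
  have h5 : ∀ v, Integrable fun w : ℂ => w⁻¹ * fderiv ℝ ψ (z - w) v := by
    intro v
    exact (((hc.fderiv_apply ℝ v).convolutionExists_right L locallyIntegrable_inv
      (continuous_fderiv_apply_comp hψ1 continuous_id continuous_const)) z : _)
  have h6 : ∫ w : ℂ, w⁻¹ * dbar (fun w => ψ (z - w)) w =
      -((fderiv ℝ u₀ z 1 + I * fderiv ℝ u₀ z I) / 2) := by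
    rw [h2, h2, ← integral_const_mul, ← integral_add (h5 1) ((h5 I).const_mul I),
      ← integral_div, ← integral_neg]
    refine integral_congr_ae (Eventually.of_forall fun w => ?_)
    simp only [dbar, h3]
    ring
  have h7 : fderiv ℝ (fun z => (π : ℂ)⁻¹ * u₀ z) z = (π : ℂ)⁻¹ • fderiv ℝ u₀ z :=
    fderiv_const_mul (h1.differentiable (by simp) z) _
  rw [h6] at h4
  simp only [dbar, h7, smul_apply, smul_eq_mul]
  have hπ : (π : ℂ) ≠ 0 := ofReal_ne_zero.2 Real.pi_ne_zero
  field_simp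
  simp only [sub_zero] at h4
  linear_combination -2 * h4

/-- The `∂̄`-Poincaré lemma. -/
theorem exists_dbar_eq {a : ℂ → ℂ} {s : Set ℂ} (hs : IsOpen s) (ha : ContDiffOn ℝ ∞ a s) {z₀ : ℂ}
    (hz₀ : z₀ ∈ s) : ∃ u : ℂ → ℂ, ContDiff ℝ ∞ u ∧ ∀ᶠ z in 𝓝 z₀, dbar u z = a z := by
  obtain ⟨r, hr, hrs⟩ := Metric.isOpen_iff.1 hs z₀ hz₀
  let b : ContDiffBump z₀ := ⟨r / 4, r / 2, by positivity, by linarith⟩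
  have hsupp : tsupport (fun z => (b z : ℂ) * a z) ⊆ Metric.closedBall z₀ (r / 2) := by
    refine (closure_mono ?_).trans_eq b.tsupport_eq
    intro z hz h
    exact hz (by simp [h])
  -- Nothing is known about `a` outside `s`, but there the bump function vanishes in a
  -- neighbourhood.
  have hψ : ContDiff ℝ ∞ fun z => (b z : ℂ) * a z := by
    refine contDiff_iff_contDiffAt.2 fun z => ?_
    by_cases hz : z ∈ s
    · exact (ofRealCLM.contDiff.comp b.contDiff).contDiffAt.mul (ha.contDiffAt (hs.mem_nhds hz))
    · refine contDiffAt_const (c := (0 : ℂ)) |>.congr_of_eventuallyEq ?_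
      refine notMem_tsupport_iff_eventuallyEq.1 fun h => hz (hrs ?_)
      exact Metric.closedBall_subset_ball (by linarith) (hsupp h)
  obtain ⟨u, hu, hu'⟩ := exists_dbar_eq_of_hasCompactSupport hψ
    ((isCompact_closedBall z₀ (r / 2)).of_isClosed_subset (isClosed_tsupport _) hsupp)
  refine ⟨u, hu, ?_⟩
  filter_upwards [b.eventuallyEq_one] with z hz
  rw [hu', hz]
  simp

end Poincare

/-! ### Charts: sections and residue fields read as complex functions, changes of coordinates. -/

namespace KleinChart

variable {X : RealRingedSpace} (c : KleinChart X)

theorem isOpenEmbedding_base : Topology.IsOpenEmbedding c.hom.base :=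
  c.isOpenImmersion.base_open

/-- The image of a chart. -/
def image : Opens X.toLRS := ⟨Set.range c.hom.base, c.isOpenEmbedding_base.isOpen_range⟩

theorem mem_image {x : X.toLRS} : x ∈ c.image ↔ ∃ z hz, c.point z hz = x := by
  constructor
  · rintro ⟨⟨y, hy⟩, rfl⟩
    obtain ⟨z, rfl⟩ := KleinPlane.proj_surjective y
    exact ⟨z, hy, rfl⟩
  · rintro ⟨z, hz, rfl⟩
    exact ⟨_, rfl⟩

theorem point_mem_image (z : DoubleHalfPlane) (hz : KleinPlane.proj z ∈ c.domain) :
    c.point z hz ∈ c.image := ⟨_, rfl⟩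

theorem proj_eq_of_point_eq {z w : DoubleHalfPlane} {hz : KleinPlane.proj z ∈ c.domain}
    {hw : KleinPlane.proj w ∈ c.domain} (h : c.point w hw = c.point z hz) :
    KleinPlane.proj w = KleinPlane.proj z :=
  congrArg Subtype.val (c.isOpenEmbedding_base.injective h)

theorem conj_mem_domain {z : DoubleHalfPlane} (hz : KleinPlane.proj z ∈ c.domain) :
    KleinPlane.proj (conj z) ∈ c.domain := (KleinPlane.proj_conj z).symm ▸ hz

theorem point_conj (z : DoubleHalfPlane) (hz : KleinPlane.proj z ∈ c.domain) :
    c.point (conj z) (c.conj_mem_domain hz) = c.point z hz := by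
  have h : (⟨_, c.conj_mem_domain hz⟩ : c.domain) = ⟨_, hz⟩ := Subtype.ext (KleinPlane.proj_conj z)
  exact congrArg c.hom.base h

theorem conj_mem_preimage {U : Opens X.toLRS} {z : ℂ} (h : z ∈ c.preimage U) :
    starRingEnd ℂ z ∈ c.preimage U := by
  obtain ⟨h1, h2, h3⟩ := h
  exact ⟨(conj ⟨z, h1⟩).2, c.conj_mem_domain h2, by
    have := c.point_conj ⟨z, h1⟩ h2
    exact this.symm ▸ h3⟩

theorem conj_mem_preimage_iff {U : Opens X.toLRS} {z : ℂ} :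
    starRingEnd ℂ z ∈ c.preimage U ↔ z ∈ c.preimage U :=
  ⟨fun h => by simpa using c.conj_mem_preimage h, c.conj_mem_preimage⟩

theorem preimage_mono {U V : Opens X.toLRS} (h : V ≤ U) : c.preimage V ⊆ c.preimage U :=
  fun _ hz => ⟨hz.1, hz.2.1, h hz.2.2⟩

open Classical in
/-- A family of elements of the residue fields, read in a chart, as a function which vanishes outside
the preimage of the domain of the family. -/
def read {U : Opens X.toLRS} (s : ∀ x : U, X.toLRS.residueField x.1) (z : ℂ) : ℂ :=
  if h : z ∈ c.preimage U then c.evalResidue ⟨z, h.1⟩ h.2.1 (s ⟨_, h.2.2⟩) else 0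

/-- The embedding of the residue field at `x` into `ℂ` defined by a point of `ℂ ∖ ℝ` over `x`. -/
def embed (z : DoubleHalfPlane) (hz : KleinPlane.proj z ∈ c.domain) {x : X.toLRS}
    (hx : c.point z hz = x) : X.toLRS.residueField x →+* ℂ :=
  hx ▸ c.evalResidue z hz

/-- Keeps the point `x` fixed while the parameter or the chart over it varies, so that elements of
one residue field can be compared without transport between equal points. -/
theorem read_eq_embed {U : Opens X.toLRS} (s : ∀ x : U, X.toLRS.residueField x.1)
    (z : DoubleHalfPlane) (hz : KleinPlane.proj z ∈ c.domain) {x : X.toLRS}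
    (hx : c.point z hz = x) (hU : x ∈ U) : c.read s z = c.embed z hz hx (s ⟨x, hU⟩) := by
  subst hx
  exact dif_pos (⟨z.2, hz, hU⟩ : z.1 ∈ c.preimage U)

theorem read_of_notMem {U : Opens X.toLRS} (s : ∀ x : U, X.toLRS.residueField x.1) {z : ℂ}
    (hz : z ∉ c.preimage U) : c.read s z = 0 := dif_neg hz

theorem read_of_mem {U : Opens X.toLRS} (s : ∀ x : U, X.toLRS.residueField x.1) {z : ℂ}
    (h : z ∈ c.preimage U) : c.read s z = c.evalResidue ⟨z, h.1⟩ h.2.1 (s ⟨_, h.2.2⟩) := dif_pos h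

theorem isSmoothFamily_iff {U : Opens X.toLRS} {s : ∀ x : U, X.toLRS.residueField x.1} :
    IsSmoothFamily s ↔ ∀ c : KleinChart X, ContDiffOn ℝ ∞ (c.read s) (c.preimage U) := by
  refine forall_congr' fun c => ⟨?_, fun h => ⟨_, h, fun z hz hU => ?_⟩⟩
  · rintro ⟨g, hg, h⟩
    refine hg.congr fun z hz => ?_
    rw [c.read_of_mem s hz]
    exact h ⟨z, hz.1⟩ hz.2.1 hz.2.2
  · exact (c.read_of_mem s (z := z.1) ⟨z.2, hz, hU⟩).symm

/-- The family of the values of a section of the structure sheaf. -/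
abbrev values {U : Opens X.toLRS} (f : X.toLRS.presheaf.obj (op U)) :
    ∀ x : U, X.toLRS.residueField x.1 := fun x => X.toLRS.evaluation x f

theorem exists_evaluation_eq (x : X.toLRS) (k : X.toLRS.residueField x) :
    ∃ (U : Opens X.toLRS) (hx : x ∈ U) (f : X.toLRS.presheaf.obj (op U)),
      X.toLRS.evaluation ⟨x, hx⟩ f = k := by
  obtain ⟨t, rfl⟩ := IsLocalRing.residue_surjective k
  obtain ⟨U, hx, f, rfl⟩ := X.toLRS.presheaf.exists_germ_eq t
  exact ⟨U, hx, f, rfl⟩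

theorem read_values {U : Opens X.toLRS} (f : X.toLRS.presheaf.obj (op U)) (z : DoubleHalfPlane)
    (hz : KleinPlane.proj z ∈ c.domain) (hU : c.point z hz ∈ U) :
    c.read (values f) z =
      KleinPlane.value (U := c.domain.isOpenEmbedding.isOpenMap.functor.obj
        ((Opens.map c.hom.base).obj U))
        (Subtype.val (c.hom.c.app (op U) f : KleinPlane.sections.presheaf.obj (op _))) z
        ⟨⟨_, hz⟩, hU, rfl⟩ := by
  rw [c.read_of_mem _ (z := z.1) ⟨z.2, hz, hU⟩]
  exact c.evalResidue_evaluation U f z hz hU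

theorem differentiableOn_read_values {U : Opens X.toLRS} (f : X.toLRS.presheaf.obj (op U)) :
    DifferentiableOn ℂ (c.read (values f)) (c.preimage U) := by
  let f' : KleinPlane.sections.presheaf.obj (op (c.domain.isOpenEmbedding.isOpenMap.functor.obj
      ((Opens.map c.hom.base).obj U))) := c.hom.c.app (op U) f
  obtain ⟨⟨g, hg, hgf⟩, -⟩ := f'.2
  rw [← c.preimage_eq] at hg
  refine hg.congr fun z hz => ?_
  rw [c.read_values f ⟨z, hz.1⟩ hz.2.1 hz.2.2]
  exact hgf ⟨z, hz.1⟩ _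

/-- No smoothness is needed: at a single point, every element of the residue field is the value of
some section of `𝒪`, and for these the symmetry is part of the definition of `𝒪` on `ℍ`. -/
theorem read_conj {U : Opens X.toLRS} (s : ∀ x : U, X.toLRS.residueField x.1) (z : ℂ) :
    c.read s (starRingEnd ℂ z) = starRingEnd ℂ (c.read s z) := by
  by_cases hz : z ∈ c.preimage U
  · obtain ⟨h1, h2, h3⟩ := hz
    obtain ⟨V, hV, f, hf⟩ := exists_evaluation_eq _ (s ⟨c.point ⟨z, h1⟩ h2, h3⟩)
    have hp := c.point_conj ⟨z, h1⟩ h2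
    have e1 := c.read_eq_embed s ⟨z, h1⟩ h2 rfl h3
    have e2 := c.read_eq_embed s (conj ⟨z, h1⟩) (c.conj_mem_domain h2) hp h3
    have e3 := c.read_eq_embed (values f) ⟨z, h1⟩ h2 rfl hV
    have e4 := c.read_eq_embed (values f) (conj ⟨z, h1⟩) (c.conj_mem_domain h2) hp hV
    rw [← hf] at e1 e2
    refine (e2.trans e4.symm).trans (Eq.trans ?_ (congrArg _ (e1.trans e3.symm)).symm)
    have hV' : c.point (conj ⟨z, h1⟩) (c.conj_mem_domain h2) ∈ V := by rw [hp]; exact hV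
    have e5 := c.read_values f ⟨z, h1⟩ h2 hV
    have e6 := c.read_values f (conj ⟨z, h1⟩) (c.conj_mem_domain h2) hV'
    refine e6.trans (Eq.trans ?_ (congrArg _ e5).symm)
    let f' : KleinPlane.sections.presheaf.obj (op (c.domain.isOpenEmbedding.isOpenMap.functor.obj
      ((Opens.map c.hom.base).obj V))) := c.hom.c.app (op V) f
    exact f'.2.2 _ _
  · rw [c.read_of_notMem s hz, c.read_of_notMem s (mt c.conj_mem_preimage_iff.1 hz), map_zero]

theorem isIso_app {U : Opens X.toLRS} (hU : U ≤ c.image) : IsIso (c.hom.c.app (op U)) := by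
  have := c.isOpenImmersion
  refine PresheafedSpace.IsOpenImmersion.c_iso' c.hom.toPshHom ((Opens.map c.hom.base).obj U) ?_
  refine Opens.ext (Set.ext fun x => ⟨fun hx => ?_, ?_⟩)
  · obtain ⟨y, rfl⟩ := hU hx
    exact ⟨y, hx, rfl⟩
  · rintro ⟨y, hy, rfl⟩
    exact hy

/-- A chart is an open immersion, so over opens in its image pulling back sections of `𝒪` is
bijective; an equivariant holomorphic function is a section on `ℍ`. -/
theorem exists_values_eq {U : Opens X.toLRS} (hU : U ≤ c.image) {g : ℂ → ℂ}
    (hg : DifferentiableOn ℂ g (c.preimage U))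
    (hc : ∀ z ∈ c.preimage U, g (starRingEnd ℂ z) = starRingEnd ℂ (g z)) :
    ∃ f : X.toLRS.presheaf.obj (op U), ∀ z ∈ c.preimage U, c.read (values f) z = g z := by
  have h1 := c.isIso_app hU
  rw [c.preimage_eq] at hg
  let F : KleinPlane.sections.presheaf.obj (op (c.domain.isOpenEmbedding.isOpenMap.functor.obj
      ((Opens.map c.hom.base).obj U))) := ⟨fun x w => g w.1, ⟨g, hg, fun z hz => rfl⟩,
        fun z hz => hc z.1 (by rw [c.preimage_eq]; exact ⟨z.2, hz⟩)⟩
  obtain ⟨f, hf⟩ := (ConcreteCategory.bijective_of_isIso (c.hom.c.app (op U))).2 F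
  refine ⟨f, fun z hz => ?_⟩
  rw [c.read_values f ⟨z, hz.1⟩ hz.2.1 hz.2.2, hf]
  rfl

theorem eq_of_read_values_eq {U : Opens X.toLRS} (hU : U ≤ c.image)
    {f f' : X.toLRS.presheaf.obj (op U)}
    (h : ∀ z ∈ c.preimage U, c.read (values f) z = c.read (values f') z) : f = f' := by
  have h1 := c.isIso_app hU
  apply (ConcreteCategory.bijective_of_isIso (c.hom.c.app (op U))).1
  refine Subtype.ext (funext fun x => funext fun w => ?_)
  obtain ⟨x, ⟨y, hy⟩, hU', rfl⟩ := x
  obtain ⟨w, rfl : KleinPlane.proj w = y⟩ := w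
  have h2 := h w.1 ⟨w.2, hy, hU'⟩
  rw [c.read_values f w hy hU', c.read_values f' w hy hU'] at h2
  exact h2

/-- Compatibility with real constants is what forces two embeddings of the same residue field to
differ by an `ℝ`-automorphism of `ℂ`. -/
theorem embed_scalars (z : DoubleHalfPlane) (hz : KleinPlane.proj z ∈ c.domain) {x : X.toLRS}
    (hx : c.point z hz = x) (r : ℝ) :
    c.embed z hz hx (X.toLRS.evaluation (U := ⊤) ⟨x, trivial⟩ (X.scalars r)) = r := by
  have h := c.read_eq_embed (values (X.scalars r)) z hz hx (U := ⊤) trivial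
  refine h.symm.trans ((c.read_values (U := ⊤) (X.scalars r) z hz trivial).trans ?_)
  have h2 := RingHom.congr_fun c.map_scalars r
  have h3 : (c.hom.c.app (op ⊤) (X.scalars r) : KleinPlane.sections.presheaf.obj (op _)) =
    (LocallyRingedSpace.Γ.map (KleinPlane.locallyRingedSpace.ofRestrict
      c.domain.isOpenEmbedding).op).hom (KleinPlane.scalars r) := h2
  rw [h3]
  rfl

/-- The functions `a + b ζ` with real `a` and `b` are sections of `𝒪`, and since `z` is not real
they take every complex value at `z`. -/
theorem embed_surjective (z : DoubleHalfPlane) (hz : KleinPlane.proj z ∈ c.domain) {x : X.toLRS}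
    (hx : c.point z hz = x) : Function.Surjective (c.embed z hz hx) := by
  intro w
  have hU : x ∈ c.image := hx ▸ c.point_mem_image z hz
  let b : ℝ := w.im / z.1.im
  let a : ℝ := w.re - b * z.1.re
  obtain ⟨f, hf⟩ := c.exists_values_eq (U := c.image) le_rfl (g := fun ζ => a + b * ζ)
    (by fun_prop) (fun ζ _ => by simp)
  refine ⟨values f ⟨x, hU⟩, ?_⟩
  rw [← c.read_eq_embed (values f) z hz hx hU, hf z.1 ⟨z.2, hz, by rw [hx]; exact hU⟩]
  have h := z.2
  apply Complex.ext
  · simp [a]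
  · simp [b]
    field_simp

theorem embed_bijective (z : DoubleHalfPlane) (hz : KleinPlane.proj z ∈ c.domain) {x : X.toLRS}
    (hx : c.point z hz = x) : Function.Bijective (c.embed z hz hx) :=
  ⟨RingHom.injective _, c.embed_surjective z hz hx⟩

/-- The change of coordinates between two charts. -/
theorem exists_transition (c c' : KleinChart X) : ∃ φ : ℂ → ℂ,
    DifferentiableOn ℂ φ (c.preimage c'.image) ∧ ∀ (z : DoubleHalfPlane)
      (hz : KleinPlane.proj z ∈ c.domain), c.point z hz ∈ c'.image →
        ∃ (w : DoubleHalfPlane) (hw : KleinPlane.proj w ∈ c'.domain), φ z = w ∧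
          c'.point w hw = c.point z hz ∧
          ∀ (U : Opens X.toLRS) (s : ∀ x : U, X.toLRS.residueField x.1),
            c.read s z = c'.read s w := by
  -- The coordinate of `c'` is itself a section `ζ` of `𝒪`. The change of coordinates is `ζ` read in
  -- `c`, so it is automatically holomorphic.
  obtain ⟨ζ, hζ⟩ := c'.exists_values_eq (U := c'.image) le_rfl (g := fun z => z)
    differentiableOn_id (fun _ _ => rfl)
  refine ⟨c.read (values ζ), c.differentiableOn_read_values ζ, fun z hz hx => ?_⟩
  obtain ⟨w, hw, hwz⟩ := c'.mem_image.1 hx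
  let e := RingEquiv.ofBijective _ (c'.embed_bijective w hw hwz)
  -- The two embeddings of the residue field differ by an `ℝ`-endomorphism of `ℂ`, that is, by the
  -- identity or by conjugation. In the second case `w` is replaced by `conj w`, which lies over the
  -- same point.
  let σ : ℂ →+* ℂ := (c.embed z hz rfl).comp e.symm.toRingHom
  have hσ : ∀ k, σ (c'.embed w hw hwz k) = c.embed z hz rfl k := fun k =>
    congrArg (c.embed z hz rfl) (e.symm_apply_apply k)
  let τ : ℂ →ₐ[ℝ] ℂ := { σ with
    commutes' := fun r => by
      have h := hσ (X.toLRS.evaluation (U := ⊤) ⟨_, trivial⟩ (X.scalars r))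
      exact (congrArg σ (c'.embed_scalars w hw hwz r)).symm.trans
        (h.trans (c.embed_scalars z hz rfl r)) }
  have hread : ∀ (U : Opens X.toLRS) (s : ∀ x : U, X.toLRS.residueField x.1),
      c.read s z = τ (c'.read s w) := by
    intro U s
    by_cases hU : c.point z hz ∈ U
    · rw [c.read_eq_embed s z hz rfl hU, c'.read_eq_embed s w hw hwz hU]
      exact (hσ _).symm
    · rw [c.read_of_notMem s fun h => hU h.2.2, c'.read_of_notMem s, map_zero]
      rintro ⟨h1, h2, h3⟩
      exact hU (hwz ▸ h3)
  have hζw : c'.read (values ζ) w = w := hζ w ⟨w.2, hw, hwz ▸ hx⟩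
  rcases Complex.real_algHom_eq_id_or_conj τ with h | h
  · refine ⟨w, hw, ?_, hwz, fun U s => ?_⟩
    · rw [hread, hζw, h]; rfl
    · rw [hread, h]; rfl
  · refine ⟨conj w, c'.conj_mem_domain hw, ?_, (c'.point_conj w hw).trans hwz, fun U s => ?_⟩
    · rw [hread, hζw, h]; rfl
    · rw [hread, h]
      exact (c'.read_conj s w).symm

/-- The smooth families over a subset of the image of a chart are the smooth functions of the
parameter that commute with complex conjugation. -/
theorem exists_smooth_read_eq {U : Opens X.toLRS} (hU : U ≤ c.image) {g : ℂ → ℂ}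
    (hg : ContDiffOn ℝ ∞ g (c.preimage U))
    (hc : ∀ z ∈ c.preimage U, g (starRingEnd ℂ z) = starRingEnd ℂ (g z)) :
    ∃ s : ∀ x : U, X.toLRS.residueField x.1, IsSmoothFamily s ∧
      ∀ z ∈ c.preimage U, c.read s z = g z := by
  -- One parameter `w x` is chosen over each point. The only other one is its conjugate, where `hc`
  -- and `read_conj` give the right value.
  choose w hw hx using fun x : U => c.mem_image.1 (hU x.2)
  choose s hs using fun x : U => c.embed_surjective (w x) (hw x) (hx x) (g (w x))
  have hread : ∀ z ∈ c.preimage U, c.read s z = g z := by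
    rintro z ⟨h1, h2, h3⟩
    set x : U := ⟨c.point ⟨z, h1⟩ h2, h3⟩ with hxdef
    have hwx : c.read s (w x) = g (w x) := by
      rw [c.read_eq_embed s (w x) (hw x) (hx x) x.2]
      exact hs x
    have hmem : (w x).1 ∈ c.preimage U := ⟨(w x).2, hw x, (hx x).symm ▸ x.2⟩
    rcases KleinPlane.eq_or_eq_conj (c.proj_eq_of_point_eq (hx x).symm) with h | h
    · have h' : z = (w x).1 := congrArg Subtype.val h
      rw [h', hwx]
    · have h' : z = starRingEnd ℂ (w x).1 := congrArg Subtype.val h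
      rw [h', c.read_conj, hwx, hc _ hmem]
  refine ⟨s, isSmoothFamily_iff.2 fun c' => ?_, hread⟩
  -- In any other chart the family is `g` composed with a holomorphic change of coordinates.
  obtain ⟨φ, hφ, h⟩ := exists_transition c' c
  have hsub : c'.preimage U ⊆ c'.preimage c.image := c'.preimage_mono hU
  have hmaps : ∀ z ∈ c'.preimage U, φ z ∈ c.preimage U ∧ c'.read s z = c.read s (φ z) := by
    rintro z ⟨h1, h2, h3⟩
    obtain ⟨v, hv, hφv, hp, hr⟩ := h ⟨z, h1⟩ h2 (hU h3)
    rw [hφv]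
    exact ⟨⟨v.2, hv, hp.symm ▸ h3⟩, hr U s⟩
  have hφ' : ContDiffOn ℝ ∞ φ (c'.preimage U) :=
    ((hφ.mono hsub).contDiffOn (c'.isOpen_preimage U)).restrict_scalars ℝ
  refine (hg.comp hφ' fun z hz => (hmaps z hz).1).congr fun z hz => ?_
  rw [(hmaps z hz).2, hread _ (hmaps z hz).1]
  rfl

theorem family_ext {U : Opens X.toLRS} (hU : U ≤ c.image)
    {s s' : ∀ x : U, X.toLRS.residueField x.1}
    (h : ∀ z ∈ c.preimage U, c.read s z = c.read s' z) : s = s' := by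
  funext x
  obtain ⟨z, hz, hx⟩ := c.mem_image.1 (hU x.2)
  have h1 := h z ⟨z.2, hz, hx.symm ▸ x.2⟩
  rw [c.read_eq_embed s z hz hx x.2, c.read_eq_embed s' z hz hx x.2] at h1
  exact (c.embed z hz hx).injective h1

theorem read_restrict {U V : Opens X.toLRS} (i : V ≤ U) (s : ∀ x : U, X.toLRS.residueField x.1)
    {z : ℂ} (hz : z ∈ c.preimage V) : c.read (fun x : V => s ⟨x, i x.2⟩) z = c.read s z := by
  rw [c.read_of_mem _ hz, c.read_of_mem _ (c.preimage_mono i hz)]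

end KleinChart

/-! ### Smooth functions, and `𝒪` inside `𝒞`. -/

section SmoothSections

variable {X : RealRingedSpace}

theorem ringRes_ext {Y : TopCat.{0}} {S : TopCat.Sheaf CommRingCat.{0} Y} {V : Opens Y}
    {m m' : (ringSheaf S).obj.obj (op V)}
    (h : ∀ x ∈ V, ∃ (W : Opens Y) (hW : W ≤ V), x ∈ W ∧ ringRes S hW m = ringRes S hW m') :
    m = m' := by
  choose W hW hx h using fun x : V => h x.1 x.2
  refine (existsUnique_gluing_ringRes W V hW (fun x hxV => Opens.mem_iSup.2 ⟨⟨x, hxV⟩, hx _⟩)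
    (fun x => ringRes S (hW x) m) ?_).unique (fun _ => rfl) (fun x => (h x).symm)
  intro x y
  rw [ringRes_ringRes, ringRes_ringRes]

/-- The ring of smooth functions over an open subset. -/
abbrev Smooth (X : RealRingedSpace) (U : Opens X.toLRS) : Type :=
  (ringSheaf (smoothSheaf X)).obj.obj (op U)

namespace Smooth

variable {U V : Opens X.toLRS}

/-- The family of elements of the residue fields that underlies a smooth function. -/
def family (t : Smooth X U) : ∀ x : U, X.toLRS.residueField x.1 :=
  Subtype.val (p := (· ∈ (smoothSections X).ring U)) t

theorem isSmoothFamily (t : Smooth X U) : IsSmoothFamily t.family :=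
  Subtype.prop (p := (· ∈ (smoothSections X).ring U)) t

theorem ext {t t' : Smooth X U} (h : t.family = t'.family) : t = t' :=
  Subtype.ext (p := (· ∈ (smoothSections X).ring U)) h

/-- The smooth function with a given family of values. -/
def mk (s : ∀ x : U, X.toLRS.residueField x.1) (hs : IsSmoothFamily s) : Smooth X U :=
  (⟨s, hs⟩ : (smoothSections X).ring U)

/-- A smooth function, read in a chart. -/
def read (t : Smooth X U) (c : KleinChart X) : ℂ → ℂ := c.read t.family

theorem contDiffOn_read (t : Smooth X U) (c : KleinChart X) :
    ContDiffOn ℝ ∞ (t.read c) (c.preimage U) :=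
  KleinChart.isSmoothFamily_iff.1 t.isSmoothFamily c

theorem read_mul (t t' : Smooth X U) (c : KleinChart X) (z : ℂ) :
    (t * t').read c z = t.read c z * t'.read c z := by
  by_cases hz : z ∈ c.preimage U
  · refine (c.read_of_mem _ hz).trans ?_
    refine Eq.trans ?_ (congrArg₂ (· * ·) (c.read_of_mem _ hz) (c.read_of_mem _ hz)).symm
    exact map_mul _ _ _
  · refine (c.read_of_notMem _ hz).trans ?_
    rw [read, c.read_of_notMem _ hz, zero_mul]

theorem read_one (c : KleinChart X) {z : ℂ} (hz : z ∈ c.preimage U) :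
    (1 : Smooth X U).read c z = 1 :=
  (c.read_of_mem _ hz).trans (map_one _)

theorem read_ringRes (h : V ≤ U) (t : Smooth X U) (c : KleinChart X) {z : ℂ}
    (hz : z ∈ c.preimage V) : read (ringRes (smoothSheaf X) h t) c z = t.read c z :=
  c.read_restrict h t.family hz

theorem differentiableAt_read (t : Smooth X U) (c : KleinChart X) {z : ℂ}
    (hz : z ∈ c.preimage U) : DifferentiableAt ℝ (t.read c) z :=
  ((t.contDiffOn_read c).contDiffAt ((c.isOpen_preimage U).mem_nhds hz)).differentiableAt (by simp)

theorem read_conj (t : Smooth X U) (c : KleinChart X) (z : ℂ) :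
    t.read c (starRingEnd ℂ z) = starRingEnd ℂ (t.read c z) := c.read_conj _ z

theorem read_ne_zero {t t' : Smooth X U} (h : t * t' = 1) (c : KleinChart X) {z : ℂ}
    (hz : z ∈ c.preimage U) : t.read c z ≠ 0 := by
  intro h0
  have h1 := read_mul t t' c z
  rw [h, read_one c hz, h0, zero_mul] at h1
  exact one_ne_zero h1

theorem ext_read {t t' : Smooth X U} (c : KleinChart X) (hU : U ≤ c.image)
    (h : ∀ z ∈ c.preimage U, t.read c z = t'.read c z) : t = t' :=
  ext (c.family_ext hU h)

theorem exists_read_eq (c : KleinChart X) (hU : U ≤ c.image) {g : ℂ → ℂ}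
    (hg : ContDiffOn ℝ ∞ g (c.preimage U))
    (hc : ∀ z ∈ c.preimage U, g (starRingEnd ℂ z) = starRingEnd ℂ (g z)) :
    ∃ t : Smooth X U, ∀ z ∈ c.preimage U, t.read c z = g z := by
  obtain ⟨s, hs, h⟩ := c.exists_smooth_read_eq hU hg hc
  exact ⟨mk s hs, h⟩

/-- A smooth function which satisfies the Cauchy-Riemann equations is locally a section of the
structure sheaf. -/
theorem exists_onSections_eq (t : Smooth X U) (ht : ∀ c, ∀ z ∈ c.preimage U, dbar (t.read c) z = 0)
    (c : KleinChart X) : ∃ f : (ringSheaf X.toLRS.sheaf).obj.obj (op (U ⊓ c.image)),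
      ringRes (smoothSheaf X) inf_le_left t = onSections (toSmooth X) (U ⊓ c.image) f := by
  have h1 : DifferentiableOn ℂ (t.read c) (c.preimage (U ⊓ c.image)) := fun z hz =>
    (differentiableAt_iff_dbar.2 ⟨t.differentiableAt_read c (c.preimage_mono inf_le_left hz),
      ht c z (c.preimage_mono inf_le_left hz)⟩).differentiableWithinAt
  obtain ⟨f, hf⟩ := c.exists_values_eq (U := U ⊓ c.image) inf_le_right h1
    (fun z _ => t.read_conj c z)
  refine ⟨f, ext_read c inf_le_right fun z hz => ?_⟩
  rw [read_ringRes _ _ _ hz]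
  exact (hf z hz).symm

end Smooth

/-- Locally a section of `𝒪` is a function of the parameter, hence determined by its values. This is
the injectivity that the descent of frames requires. -/
theorem onSections_toSmooth_injective (hX : ∀ x : X.toLRS, ∃ c : KleinChart X, x ∈ c.image)
    (V : Opens X.toLRS) : Function.Injective (onSections (toSmooth X) V) := by
  intro f f' hff
  refine ringRes_ext fun x hx => ?_
  obtain ⟨c, hc⟩ := hX x
  refine ⟨V ⊓ c.image, inf_le_left, ⟨hx, hc⟩, c.eq_of_read_values_eq inf_le_right fun z hz => ?_⟩
  have h := congrArg (ringRes (smoothSheaf X) (inf_le_left : V ⊓ c.image ≤ V)) hff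
  rw [← onSections_ringRes, ← onSections_ringRes] at h
  exact congrArg (fun t : Smooth X (V ⊓ c.image) => t.read c z) h

end SmoothSections

/-! ### Open and compact sets of points given by sets of parameters. -/

namespace KleinChart

variable {X : RealRingedSpace} (c : KleinChart X)

/-- The saturation of an open set is its union with its conjugate. -/
theorem isOpenMap_proj : IsOpenMap KleinPlane.proj := by
  intro O hO
  refine isOpen_coinduced.2 ?_
  have h : Quotient.mk orbitSetoid ⁻¹' (KleinPlane.proj '' O) = O ∪ conj ⁻¹' O := by
    ext z
    constructor
    · rintro ⟨w, hw, hwz⟩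
      rcases KleinPlane.eq_or_eq_conj hwz with rfl | rfl
      · exact Or.inl hw
      · exact Or.inr hw
    · rintro (h | h)
      · exact ⟨z, h, rfl⟩
      · exact ⟨conj z, h, KleinPlane.proj_conj z⟩
  exact h ▸ hO.union (hO.preimage continuous_conj)

/-- The open subset of the image of a chart defined by an open set of parameters. -/
def opens {O : Set ℂ} (hO : IsOpen O) : Opens X.toLRS :=
  ⟨c.hom.base '' (Subtype.val ⁻¹' (KleinPlane.proj '' (Subtype.val ⁻¹' O))),
    c.isOpenEmbedding_base.isOpenMap _ ((isOpenMap_proj _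
      (hO.preimage continuous_subtype_val)).preimage continuous_subtype_val)⟩

theorem mem_opens {O : Set ℂ} (hO : IsOpen O) {x : X.toLRS} :
    x ∈ c.opens hO ↔ ∃ (z : DoubleHalfPlane) (hz : KleinPlane.proj z ∈ c.domain),
      z.1 ∈ O ∧ c.point z hz = x := by
  constructor
  · rintro ⟨⟨y, hy⟩, ⟨z, hz, rfl : KleinPlane.proj z = y⟩, rfl⟩
    exact ⟨z, hy, hz, rfl⟩
  · rintro ⟨z, hz, hO, rfl⟩
    exact ⟨_, ⟨z, hO, rfl⟩, rfl⟩

theorem opens_le_image {O : Set ℂ} (hO : IsOpen O) : c.opens hO ≤ c.image := by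
  intro x hx
  obtain ⟨z, hz, -, rfl⟩ := (c.mem_opens hO).1 hx
  exact c.point_mem_image z hz

theorem mem_preimage_opens {O : Set ℂ} {hO : IsOpen O} {z : ℂ} (h : z ∈ c.preimage (c.opens hO)) :
    z ∈ O ∨ starRingEnd ℂ z ∈ O := by
  obtain ⟨h1, h2, h3⟩ := h
  obtain ⟨w, hw, hwO, hwz⟩ := (c.mem_opens hO).1 h3
  rcases KleinPlane.eq_or_eq_conj (c.proj_eq_of_point_eq hwz) with rfl | rfl
  · exact Or.inl hwO
  · exact Or.inr hwO

theorem opens_le {O : Set ℂ} (hO : IsOpen O) {U : Opens X.toLRS} (h : O ⊆ c.preimage U) :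
    c.opens hO ≤ U := by
  intro x hx
  obtain ⟨z, hz, hzO, rfl⟩ := (c.mem_opens hO).1 hx
  exact (h hzO).2.2

/-- Meant for supports: in a Hausdorff space this set is closed, so a function supported on it
extends by zero. -/
theorem isCompact_points {K : Set ℂ} (hK : IsCompact K) (h : K ⊆ c.preimage ⊤) :
    IsCompact {x : X.toLRS | ∃ (z : DoubleHalfPlane) (hz : KleinPlane.proj z ∈ c.domain),
      z.1 ∈ K ∧ c.point z hz = x} := by
  let f : c.preimage ⊤ → X.toLRS := fun z => c.point ⟨z.1, z.2.1⟩ z.2.2.1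
  have hf : Continuous f := by
    refine c.isOpenEmbedding_base.continuous.comp (Continuous.subtype_mk ?_ _)
    exact KleinPlane.continuous_proj.comp (Continuous.subtype_mk continuous_subtype_val _)
  have h1 : IsCompact (Subtype.val ⁻¹' K : Set (c.preimage ⊤)) :=
    Topology.IsInducing.subtypeVal.isCompact_preimage_iff (by simpa using h) |>.2 hK
  convert h1.image hf using 1
  ext x
  constructor
  · rintro ⟨z, hz, hzK, rfl⟩
    exact ⟨⟨z.1, z.2, hz, trivial⟩, hzK, rfl⟩
  · rintro ⟨z, hzK, rfl⟩
    exact ⟨⟨z.1, z.2.1⟩, z.2.2.1, hzK, rfl⟩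

end KleinChart

/-! ### Bump functions and partitions of unity. -/

section Partition

variable {X : RealRingedSpace}

-- A bump function `b` of the parameter becomes equivariant as `b z + b (conj z)`. Its support in
-- the surface is the image of a closed disc, which is closed, so it extends by zero. Being real and
-- nonnegative in every chart prevents cancellation when such functions are added.
open Classical in
theorem exists_bump [T2Space X.toLRS] (c : KleinChart X) {x : X.toLRS} (hx : x ∈ c.image)
    {U : Opens X.toLRS} (hU : x ∈ U) : ∃ ρ : Smooth X ⊤,
      (∃ Q : Set X.toLRS, IsClosed Q ∧ Q ⊆ U ∧ ∀ y, y.1 ∉ Q → ρ.family y = 0) ∧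
      (∃ N : Opens X.toLRS, x ∈ N ∧ ∀ y : (⊤ : Opens X.toLRS), y.1 ∈ N → ρ.family y ≠ 0) ∧
      ∀ (c' : KleinChart X) (z : ℂ), ∃ t : ℝ, 0 ≤ t ∧ ρ.read c' z = t := by
  obtain ⟨z₀, hz₀, hzx⟩ := c.mem_image.1 hx
  have hmem : z₀.1 ∈ c.preimage U := ⟨z₀.2, hz₀, hzx.symm ▸ hU⟩
  obtain ⟨r, hr, hrU⟩ := Metric.isOpen_iff.1 (c.isOpen_preimage U) _ hmem
  let b : ContDiffBump z₀.1 := ⟨r / 4, r / 2, by positivity, by linarith⟩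
  have hK : Metric.closedBall z₀.1 (r / 2) ⊆ c.preimage U :=
    (Metric.closedBall_subset_ball (by linarith)).trans hrU
  let Q := {x : X.toLRS | ∃ (z : DoubleHalfPlane) (hz : KleinPlane.proj z ∈ c.domain),
      z.1 ∈ Metric.closedBall z₀.1 (r / 2) ∧ c.point z hz = x}
  have hQ : IsClosed Q := (c.isCompact_points (isCompact_closedBall _ _)
    (hK.trans (c.preimage_mono le_top))).isClosed
  have hQU : Q ⊆ U := by
    rintro y ⟨z, hz, hzK, rfl⟩
    exact (hK hzK).2.2
  let g : ℂ → ℂ := fun z => ((b z + b (starRingEnd ℂ z) : ℝ) : ℂ)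
  have hg : ContDiff ℝ ∞ g := Complex.ofRealCLM.contDiff.comp
    (b.contDiff.add (b.contDiff.comp Complex.conjCLE.contDiff))
  obtain ⟨s, hs, hsg⟩ := c.exists_smooth_read_eq (U := c.image) le_rfl hg.contDiffOn
    (fun z _ => by
      simp only [g, Complex.conj_conj, Complex.conj_ofReal]
      rw [add_comm])
  have hsupp : ∀ z ∈ c.preimage c.image, g z ≠ 0 → ∀ h1 h2, c.point ⟨z, h1⟩ h2 ∈ Q := by
    intro z hz hgz h1 h2
    have : b z ≠ 0 ∨ b (starRingEnd ℂ z) ≠ 0 := by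
      by_contra! h
      exact hgz (by simp [g, h.1, h.2])
    have hball : ∀ w, b w ≠ 0 → w ∈ Metric.closedBall z₀.1 (r / 2) := fun w hw =>
      b.tsupport_eq ▸ subset_tsupport _ hw
    rcases this with h | h
    · exact ⟨_, h2, hball _ h, rfl⟩
    · exact ⟨conj ⟨z, h1⟩, c.conj_mem_domain h2, hball _ h, c.point_conj _ _⟩
  let σ : ∀ y : (⊤ : Opens X.toLRS), X.toLRS.residueField y.1 := fun y =>
    if hy : y.1 ∈ c.image then s ⟨y.1, hy⟩ else 0
  have hσs : ∀ (y) (hy : y ∈ c.image), σ ⟨y, trivial⟩ = s ⟨y, hy⟩ := fun y hy => dif_pos hy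
  have hσQ : ∀ y, y.1 ∉ Q → σ y = 0 := by
    rintro ⟨y, hyt⟩ hy
    by_cases hyc : y ∈ c.image
    · rw [hσs y hyc]
      obtain ⟨z, hz, rfl⟩ := c.mem_image.1 hyc
      have hzi : z.1 ∈ c.preimage c.image := ⟨z.2, hz, hyc⟩
      have h0 : g z = 0 := by
        by_contra h
        exact hy (hsupp z hzi h z.2 hz)
      have h1 := c.read_eq_embed s z hz rfl hyc
      rw [hsg z hzi, h0] at h1
      exact (map_eq_zero _).1 h1.symm
    · exact dif_neg hyc
  -- Smoothness is local: either the point lies in the image of `c`, or it lies in the open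
  -- complement of `Q`, where the family is zero.
  have hσ : IsSmoothFamily σ := by
    refine (smoothSections X).loc σ fun y => ?_
    by_cases hyc : y.1 ∈ c.image
    · refine ⟨c.image, le_top, hyc, ?_⟩
      have : (fun w : c.image => σ ⟨w.1, trivial⟩) = s := funext fun w => hσs w w.2
      rw [this]
      exact hs
    · refine ⟨⟨Qᶜ, hQ.isOpen_compl⟩, le_top, ?_, ?_⟩
      · rintro ⟨z, hz, -, h⟩
        exact hyc (h ▸ c.point_mem_image z hz)
      · have : (fun w : (⟨Qᶜ, hQ.isOpen_compl⟩ : Opens X.toLRS) => σ ⟨w, trivial⟩) = 0 :=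
          funext fun w => hσQ _ w.2
        exact this ▸ ((smoothSections X).ring _).zero_mem
  have hread : ∀ z ∈ c.preimage c.image, c.read σ z = g z := by
    rintro z ⟨h1, h2, h3⟩
    rw [← hsg z ⟨h1, h2, h3⟩, c.read_eq_embed σ ⟨z, h1⟩ h2 rfl trivial, hσs _ h3]
    exact (c.read_eq_embed s ⟨z, h1⟩ h2 rfl h3).symm
  refine ⟨Smooth.mk σ hσ, ⟨Q, hQ, hQU, hσQ⟩, ?_, ?_⟩
  · refine ⟨c.opens (Metric.isOpen_ball (x := z₀.1) (ε := r / 2)), ?_, ?_⟩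
    · exact (c.mem_opens _).2 ⟨z₀, hz₀, Metric.mem_ball_self (by positivity), hzx⟩
    · rintro ⟨y, hy⟩ hyN
      obtain ⟨z, hz, hzb, rfl⟩ := (c.mem_opens _).1 hyN
      intro h0
      have h1 := c.read_eq_embed σ z hz rfl trivial
      have h2 : σ ⟨c.point z hz, trivial⟩ = 0 := h0
      rw [h2, map_zero, hread z ⟨z.2, hz, c.point_mem_image z hz⟩] at h1
      have h3 : 0 < b z.1 := b.pos_of_mem_ball hzb
      have h4 : 0 ≤ b (starRingEnd ℂ z.1) := b.nonneg
      have h5 : b z.1 + b (starRingEnd ℂ z.1) = 0 := Complex.ofReal_eq_zero.1 h1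
      linarith
  · intro c' z
    change ∃ t : ℝ, 0 ≤ t ∧ c'.read σ z = t
    by_cases hz : z ∈ c'.preimage c.image
    · obtain ⟨φ, -, hφ⟩ := KleinChart.exists_transition c' c
      obtain ⟨h1, h2, h3⟩ := hz
      obtain ⟨w, hw, -, hp, hr⟩ := hφ ⟨z, h1⟩ h2 h3
      refine ⟨_, add_nonneg (b.nonneg (x := w.1)) (b.nonneg (x := starRingEnd ℂ w.1)), ?_⟩
      rw [hr ⊤ σ]
      exact hread w ⟨w.2, hw, hp.symm ▸ h3⟩
    · refine ⟨0, le_rfl, ?_⟩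
      by_cases hzt : z ∈ c'.preimage ⊤
      · obtain ⟨h1, h2, h3⟩ := hzt
        have h4 : σ ⟨c'.point ⟨z, h1⟩ h2, h3⟩ = 0 := dif_neg fun h => hz ⟨h1, h2, h⟩
        rw [c'.read_eq_embed σ ⟨z, h1⟩ h2 rfl h3, h4, map_zero, Complex.ofReal_zero]
      · rw [c'.read_of_notMem _ hzt, Complex.ofReal_zero]

/-- Smooth partitions of unity. -/
theorem exists_partition [T2Space X.toLRS] [CompactSpace X.toLRS]
    (hX : ∀ x : X.toLRS, ∃ c : KleinChart X, x ∈ c.image) (U : X.toLRS → Opens X.toLRS)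
    (hU : ∀ x, x ∈ U x) : ∃ (T : Finset X.toLRS) (ρ : X.toLRS → Smooth X ⊤),
      (∀ k, ∃ Q : Set X.toLRS, IsClosed Q ∧ Q ⊆ U k ∧ ∀ y, y.1 ∉ Q → (ρ k).family y = 0) ∧
      ∀ (c : KleinChart X), ∀ z ∈ c.preimage ⊤, ∑ k ∈ T, (ρ k).read c z = 1 := by
  choose c hc using hX
  choose ρ hQ hN' hpos using fun x => exists_bump (c x) (hc x) (hU x)
  choose N hN using hN'
  obtain ⟨T, hT⟩ := CompactSpace.elim_nhds_subcover (fun x => (N x : Set X.toLRS))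
    fun x => (N x).isOpen.mem_nhds (hN x).1
  have hsum : ∀ c : KleinChart X, ∀ z ∈ c.preimage ⊤, ∑ k ∈ T, (ρ k).read c z ≠ 0 := by
    rintro c z ⟨h1, h2, h3⟩
    choose t ht0 ht using fun k => hpos k c z
    simp_rw [ht]
    rw [← Complex.ofReal_sum, Complex.ofReal_ne_zero]
    have hmem : c.point ⟨z, h1⟩ h2 ∈ ⋃ x ∈ T, (N x : Set X.toLRS) := hT ▸ trivial
    simp only [Set.mem_iUnion] at hmem
    obtain ⟨k, hk, hkN⟩ := hmem
    refine (Finset.sum_pos' (fun k _ => ht0 k) ⟨k, hk, lt_of_le_of_ne (ht0 k) fun h0 => ?_⟩).ne'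
    have h4 := ht k
    rw [← h0] at h4
    have h5 := (c.read_eq_embed (ρ k).family ⟨z, h1⟩ h2 rfl h3).symm.trans h4
    rw [Complex.ofReal_zero, map_eq_zero] at h5
    exact (hN k).2 _ hkN h5
  -- Normalization is done pointwise in the residue fields; its smoothness is checked in charts,
  -- where the sum has no zeros.
  let τ : X.toLRS → ∀ y : (⊤ : Opens X.toLRS), X.toLRS.residueField y.1 := fun k y =>
    (ρ k).family y / ∑ j ∈ T, (ρ j).family y
  have hτ : ∀ k (c : KleinChart X), ∀ z ∈ c.preimage ⊤,
      c.read (τ k) z = (ρ k).read c z / ∑ j ∈ T, (ρ j).read c z := by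
    rintro k c z hz
    rw [c.read_of_mem _ hz, map_div₀, map_sum, Smooth.read, c.read_of_mem _ hz]
    congr 1
    exact Finset.sum_congr rfl fun j _ => (c.read_of_mem _ hz).symm
  have hτs : ∀ k, IsSmoothFamily (τ k) := fun k => KleinChart.isSmoothFamily_iff.2 fun c =>
    (((ρ k).contDiffOn_read c).mul ((ContDiffOn.sum fun j _ => (ρ j).contDiffOn_read c).inv
      (hsum c))).congr fun z hz => (hτ k c z hz).trans (div_eq_mul_inv _ _)
  refine ⟨T, fun k => Smooth.mk (τ k) (hτs k), fun k => ?_, fun c z hz => ?_⟩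
  · obtain ⟨Q, h1, h2, h3⟩ := hQ k
    refine ⟨Q, h1, h2, fun y hy => ?_⟩
    change (ρ k).family y / _ = 0
    rw [h3 y hy, zero_div]
  · refine (Finset.sum_congr rfl fun k _ => hτ k c z hz).trans ?_
    rw [← Finset.sum_div, div_self (hsum c z hz)]

end Partition

/-! ### The glued `∂̄`-operator and its parallel frames. -/

section Connection

open Filter Topology

variable {X : RealRingedSpace} {M : SheafOfModules.{0} (ringSheaf (smoothSheaf X))}

/-- The coefficient of a section with respect to a frame. -/
def coeff {U V : Opens X.toLRS} {e : M.val.obj (op U)} (he : IsFrame M e) (m : M.val.obj (op V)) :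
    Smooth X (V ⊓ U) :=
  ((he (V ⊓ U) inf_le_right).2 (res M inf_le_left m)).choose

theorem coeff_smul {U V : Opens X.toLRS} {e : M.val.obj (op U)} (he : IsFrame M e)
    (m : M.val.obj (op V)) : coeff he m • res M inf_le_right e = res M inf_le_left m :=
  ((he (V ⊓ U) inf_le_right).2 (res M inf_le_left m)).choose_spec

theorem IsFrame.eq_of_smul_eq {U W : Opens X.toLRS} {e : M.val.obj (op U)} (he : IsFrame M e)
    (hW : W ≤ U) {r r' : Smooth X W} (h : r • res M hW e = r' • res M hW e) : r = r' :=
  (he W hW).1 h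

theorem ringRes_coeff_smul {U V W : Opens X.toLRS} {e : M.val.obj (op U)} (he : IsFrame M e)
    (m : M.val.obj (op V)) (hV : W ≤ V) (hU : W ≤ U) :
    (ringRes (smoothSheaf X) (le_inf hV hU) (coeff he m) : Smooth X W) • res M hU e =
      res M hV m := by
  have h := congrArg (res M (le_inf hV hU)) (coeff_smul he m)
  rwa [res_smul, res_res, res_res] at h

/-- The inverse is the coefficient of `e` with respect to `m`. -/
theorem exists_coeff_mul_eq_one {U V : Opens X.toLRS} {e : M.val.obj (op U)} (he : IsFrame M e)
    {m : M.val.obj (op V)} (hm : IsFrame M m) : ∃ r : Smooth X (V ⊓ U), coeff he m * r = 1 := by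
  obtain ⟨r, hr⟩ := (hm (V ⊓ U) inf_le_left).2 (res M inf_le_right e)
  refine ⟨r, he.eq_of_smul_eq inf_le_right ?_⟩
  dsimp only at hr
  rw [sections_mul_comm, mul_smul, coeff_smul, hr, one_smul]

theorem read_coeff_ne_zero {U V : Opens X.toLRS} {e : M.val.obj (op U)} (he : IsFrame M e)
    {m : M.val.obj (op V)} (hm : IsFrame M m) (c : KleinChart X) {z : ℂ}
    (hz : z ∈ c.preimage (V ⊓ U)) : (coeff he m).read c z ≠ 0 := by
  obtain ⟨r, hr⟩ := exists_coeff_mul_eq_one he hm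
  exact Smooth.read_ne_zero hr c hz

theorem IsFrame.smul_res {U W : Opens X.toLRS} {e : M.val.obj (op U)} (he : IsFrame M e)
    (hW : W ≤ U) {r r' : Smooth X W} (h : r * r' = 1) : IsFrame M (r • res M hW e) := by
  intro V hV
  have h1 : (ringRes (smoothSheaf X) hV r : Smooth X V) * ringRes (smoothSheaf X) hV r' = 1 := by
    rw [← map_mul, h, map_one]
  have h2 : ∀ s : Smooth X V, s • res M hV (r • res M hW e) =
      (s * ringRes (smoothSheaf X) hV r : Smooth X V) • res M (hV.trans hW) e := by
    intro s
    rw [res_smul, res_res, mul_smul]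
  constructor
  · intro s s' hs
    have h3 := he.eq_of_smul_eq (hV.trans hW) ((h2 s).symm.trans (Eq.trans hs (h2 s')))
    have h4 := congrArg (fun t : Smooth X V => t * ringRes (smoothSheaf X) hV r') h3
    rwa [mul_assoc, h1, mul_one, mul_assoc, h1, mul_one] at h4
  · intro m
    obtain ⟨s, hs⟩ := (he V (hV.trans hW)).2 m
    refine ⟨(s * ringRes (smoothSheaf X) hV r' : Smooth X V), ?_⟩
    dsimp only at hs ⊢
    rw [h2, mul_assoc, sections_mul_comm (ringRes (smoothSheaf X) hV r'), h1, mul_one, hs]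

variable (M) in
/-- Local frames of `M`, and a partition of unity subordinate to their domains. -/
structure FramePartition where
  U : X.toLRS → Opens X.toLRS
  e : ∀ k, M.val.obj (op (U k))
  isFrame : ∀ k, IsFrame M (e k)
  mem : ∀ k, k ∈ U k
  T : Finset X.toLRS
  ρ : X.toLRS → Smooth X ⊤
  support : ∀ k, ∃ Q : Set X.toLRS, IsClosed Q ∧ Q ⊆ U k ∧ ∀ y, y.1 ∉ Q → (ρ k).family y = 0
  sum_eq_one : ∀ (c : KleinChart X), ∀ z ∈ c.preimage ⊤, ∑ k ∈ T, (ρ k).read c z = 1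

namespace FramePartition

variable (P : FramePartition M)

/-- The support of `ρ k` is contained in a closed subset of `U k`. This disposes of the summands of
`form` at parameters where the `k`-th coefficient is not defined. -/
theorem eventually_read_eq_zero (c : KleinChart X) (k : X.toLRS) {z : ℂ} (hz : z ∈ c.preimage ⊤)
    (hk : z ∉ c.preimage (P.U k)) : ∀ᶠ w in 𝓝 z, (P.ρ k).read c w = 0 := by
  obtain ⟨Q, hQ, hQU, h0⟩ := P.support k
  have hmem : z ∈ c.preimage ⟨Qᶜ, hQ.isOpen_compl⟩ :=
    ⟨hz.1, hz.2.1, fun h => hk ⟨hz.1, hz.2.1, hQU h⟩⟩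
  filter_upwards [(c.isOpen_preimage _).mem_nhds hmem] with w hw
  have hw' : w ∈ c.preimage ⊤ := c.preimage_mono le_top hw
  have h1 : (P.ρ k).family ⟨_, hw'.2.2⟩ = 0 := h0 _ fun h => hw.2.2 h
  rw [Smooth.read, c.read_of_mem _ hw', h1, map_zero]

/-- The connection form, in a chart, of the `∂̄`-operator on `M` obtained by gluing the trivial
operators of the frames with the partition of unity, relative to a frame `m`. -/
def form {V : Opens X.toLRS} (m : M.val.obj (op V)) (c : KleinChart X) (z : ℂ) : ℂ :=
  ∑ k ∈ P.T, (P.ρ k).read c z *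
    (dbar ((coeff (P.isFrame k) m).read c) z / (coeff (P.isFrame k) m).read c z)

theorem contDiffOn_form {V : Opens X.toLRS} {m : M.val.obj (op V)} (hm : IsFrame M m)
    (c : KleinChart X) : ContDiffOn ℝ ∞ (P.form m c) (c.preimage V) := by
  refine ContDiffOn.sum fun k _ z hz => ContDiffAt.contDiffWithinAt ?_
  have hzt : z ∈ c.preimage ⊤ := c.preimage_mono le_top hz
  by_cases hk : z ∈ c.preimage (P.U k)
  · have hzk : z ∈ c.preimage (V ⊓ P.U k) := ⟨hz.1, hz.2.1, hz.2.2, hk.2.2⟩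
    have hn := (c.isOpen_preimage (V ⊓ P.U k)).mem_nhds hzk
    have h1 := (coeff (P.isFrame k) m).contDiffOn_read c
    have h2 := contDiffOn_dbar (c.isOpen_preimage _) h1
    simp_rw [div_eq_mul_inv]
    exact (((P.ρ k).contDiffOn_read c).contDiffAt ((c.isOpen_preimage ⊤).mem_nhds hzt)).mul
      ((h2.contDiffAt hn).mul ((h1.contDiffAt hn).inv (read_coeff_ne_zero _ hm c hzk)))
  · refine (contDiffAt_const (c := (0 : ℂ))).congr_of_eventuallyEq ?_
    filter_upwards [P.eventually_read_eq_zero c k hzt hk] with w hw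
    rw [hw, zero_mul]

/-- The effect of a change of frame on the connection form. -/
theorem form_smul {V V' W : Opens X.toLRS} {m : M.val.obj (op V)} (hm : IsFrame M m)
    {m' : M.val.obj (op V')} (hV : W ≤ V) (hV' : W ≤ V') {h h' : Smooth X W} (hh : h * h' = 1)
    (hmm : res M hV' m' = h • res M hV m) (c : KleinChart X) {z : ℂ} (hz : z ∈ c.preimage W) :
    P.form m' c z = P.form m c z + dbar (h.read c) z / h.read c z := by
  have hzt : z ∈ c.preimage ⊤ := c.preimage_mono le_top hz
  -- Because the weights sum to one, the extra term can be distributed over the summands; each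
  -- summand is then the product rule for a logarithmic derivative.
  rw [← one_mul (dbar (h.read c) z / h.read c z), ← P.sum_eq_one c z hzt, Finset.sum_mul, form, form,
    ← Finset.sum_add_distrib]
  refine Finset.sum_congr rfl fun k _ => ?_
  by_cases hk : z ∈ c.preimage (P.U k)
  · have hzk : z ∈ c.preimage (W ⊓ P.U k) := ⟨hz.1, hz.2.1, hz.2.2, hk.2.2⟩
    have hzVk : z ∈ c.preimage (V ⊓ P.U k) := ⟨hz.1, hz.2.1, hV hz.2.2, hk.2.2⟩
    have h1 : (ringRes (smoothSheaf X) (le_inf (inf_le_left.trans hV') inf_le_right)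
        (coeff (P.isFrame k) m') : Smooth X (W ⊓ P.U k)) =
        ringRes (smoothSheaf X) inf_le_left h *
          ringRes (smoothSheaf X) (le_inf (inf_le_left.trans hV) inf_le_right)
            (coeff (P.isFrame k) m) := by
      refine (P.isFrame k).eq_of_smul_eq inf_le_right ?_
      rw [mul_smul, ringRes_coeff_smul, ringRes_coeff_smul]
      have h2 := congrArg (res M (inf_le_left : W ⊓ P.U k ≤ W)) hmm
      rwa [res_smul, res_res, res_res] at h2
    have h3 : (coeff (P.isFrame k) m').read c =ᶠ[𝓝 z]
        fun w => h.read c w * (coeff (P.isFrame k) m).read c w := by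
      filter_upwards [(c.isOpen_preimage _).mem_nhds hzk] with w hw
      have h4 := congrArg (fun t : Smooth X (W ⊓ P.U k) => t.read c w) h1
      rw [Smooth.read_mul] at h4
      rwa [Smooth.read_ringRes _ _ _ hw, Smooth.read_ringRes _ _ _ hw,
        Smooth.read_ringRes _ _ _ hw] at h4
    rw [dbar_congr h3, h3.eq_of_nhds, dbar_mul (h.differentiableAt_read c hz)
      ((coeff (P.isFrame k) m).differentiableAt_read c hzVk)]
    have h5 := read_coeff_ne_zero (P.isFrame k) hm c hzVk
    have h6 := Smooth.read_ne_zero hh c hz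
    field_simp
    ring
  · rw [(P.eventually_read_eq_zero c k hzt hk).self_of_nhds, zero_mul, zero_mul, zero_mul, zero_add]

/-- The effect of a change of chart on the connection form. -/
theorem form_chart {V : Opens X.toLRS} {m : M.val.obj (op V)} (c c' : KleinChart X)
    {φ : ℂ → ℂ} (hφ : DifferentiableOn ℂ φ (c.preimage c'.image))
    (hr : ∀ z ∈ c.preimage c'.image, ∀ (U : Opens X.toLRS) (s : Smooth X U),
      (φ z ∈ c'.preimage U ↔ z ∈ c.preimage U) ∧ s.read c z = s.read c' (φ z))
    {z : ℂ} (hz : z ∈ c.preimage V) (hzc : z ∈ c.preimage c'.image) :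
    P.form m c z = starRingEnd ℂ (deriv φ z) * P.form m c' (φ z) := by
  have hzt : z ∈ c.preimage ⊤ := c.preimage_mono le_top hz
  rw [form, form, Finset.mul_sum]
  refine Finset.sum_congr rfl fun k _ => ?_
  rw [← (hr z hzc _ (P.ρ k)).2]
  by_cases hk : z ∈ c.preimage (P.U k)
  · have hzk : z ∈ c.preimage (V ⊓ P.U k) := ⟨hz.1, hz.2.1, hz.2.2, hk.2.2⟩
    have hn := (c.isOpen_preimage c'.image).mem_nhds hzc
    have h1 : (coeff (P.isFrame k) m).read c =ᶠ[𝓝 z]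
        fun w => (coeff (P.isFrame k) m).read c' (φ w) := by
      filter_upwards [hn] with w hw
      exact (hr w hw _ _).2
    rw [dbar_congr h1, h1.eq_of_nhds, dbar_comp (hφ.differentiableAt hn)
      (Smooth.differentiableAt_read _ c' ((hr z hzc _ (coeff (P.isFrame k) m)).1.2 hzk))]
    ring
  · rw [(P.eventually_read_eq_zero c k hzt hk).self_of_nhds, zero_mul, zero_mul, mul_zero]

/-- The functions `ρ k` and the coefficients commute with conjugation, and so does `∂̄` by
`dbar_conj`. -/
theorem form_conj {V : Opens X.toLRS} {m : M.val.obj (op V)} (c : KleinChart X) {z : ℂ}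
    (hz : z ∈ c.preimage V) : P.form m c (starRingEnd ℂ z) = starRingEnd ℂ (P.form m c z) := by
  have hzt : z ∈ c.preimage ⊤ := c.preimage_mono le_top hz
  rw [form, form, map_sum]
  refine Finset.sum_congr rfl fun k _ => ?_
  rw [Smooth.read_conj, Smooth.read_conj, map_mul, map_div₀]
  by_cases hk : z ∈ c.preimage (P.U k)
  · have hzk : z ∈ c.preimage (V ⊓ P.U k) := ⟨hz.1, hz.2.1, hz.2.2, hk.2.2⟩
    have h1 : (coeff (P.isFrame k) m).read c = fun w =>
        starRingEnd ℂ ((coeff (P.isFrame k) m).read c (starRingEnd ℂ w)) := by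
      funext w
      rw [Smooth.read_conj, Complex.conj_conj]
    have h2 : DifferentiableAt ℝ ((coeff (P.isFrame k) m).read c)
        (starRingEnd ℂ (starRingEnd ℂ z)) := by
      rw [Complex.conj_conj]
      exact Smooth.differentiableAt_read _ c hzk
    have h3 := dbar_conj h2
    rw [← h1, Complex.conj_conj] at h3
    rw [h3]
  · rw [(P.eventually_read_eq_zero c k hzt hk).self_of_nhds, map_zero, zero_mul, zero_mul]

/-- A frame is parallel if its connection form vanishes. -/
def IsParallel {V : Opens X.toLRS} (m : M.val.obj (op V)) : Prop :=
  ∀ (c : KleinChart X), ∀ z ∈ c.preimage V, P.form m c z = 0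

/-- It suffices to test parallelism at one parameter of every point. -/
theorem isParallel_of_chart (c : KleinChart X) {O : Set ℂ} (hO : IsOpen O)
    {m : M.val.obj (op (c.opens hO))} (h : ∀ z ∈ O ∩ c.preimage (c.opens hO), P.form m c z = 0) :
    P.IsParallel m := by
  -- Every parameter over `c.opens hO` lies in `O` or has its conjugate there, so `form_conj`
  -- settles the chart `c`; other charts follow by `form_chart`.
  have h1 : ∀ z ∈ c.preimage (c.opens hO), P.form m c z = 0 := by
    intro z hz
    rcases c.mem_preimage_opens hz with hzO | hzO
    · exact h z ⟨hzO, hz⟩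
    · have h2 := P.form_conj (m := m) c hz
      rw [h _ ⟨hzO, c.conj_mem_preimage hz⟩] at h2
      exact (map_eq_zero _).1 h2.symm
  intro c' z hz
  obtain ⟨φ, hφ, hr⟩ := KleinChart.exists_transition c' c
  have hr' : ∀ z ∈ c'.preimage c.image, ∀ (U : Opens X.toLRS) (s : Smooth X U),
      (φ z ∈ c.preimage U ↔ z ∈ c'.preimage U) ∧ s.read c' z = s.read c (φ z) := by
    rintro z ⟨hz1, hz2, hz3⟩ U s
    obtain ⟨w, hw, hφw, hp, hs⟩ := hr ⟨z, hz1⟩ hz2 hz3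
    rw [hφw]
    refine ⟨⟨fun hU => ⟨hz1, hz2, hp ▸ hU.2.2⟩, fun hU => ⟨w.2, hw, hp.symm ▸ hU.2.2⟩⟩, hs U _⟩
  have hzc : z ∈ c'.preimage c.image := c'.preimage_mono (c.opens_le_image hO) hz
  rw [P.form_chart c' c hφ hr' hz hzc, h1 _ ((hr' z hzc _ (0 : Smooth X (c.opens hO))).1.2 hz),
    mul_zero]

/-- Existence of parallel frames. -/
theorem exists_isParallel (c : KleinChart X) {x : X.toLRS} (hx : x ∈ c.image) :
    ∃ (V : Opens X.toLRS) (m : M.val.obj (op V)), x ∈ V ∧ IsFrame M m ∧ P.IsParallel m := by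
  obtain ⟨z₀, hz₀, rfl⟩ := c.mem_image.1 hx
  set x := c.point z₀ hz₀ with hxdef
  have hmem : z₀.1 ∈ c.preimage (P.U x) := ⟨z₀.2, hz₀, P.mem x⟩
  -- The equation is `∂̄u = -α`, with `α` the form of the frame `P.e x`, so that the factor `exp u`
  -- cancels `α`.
  obtain ⟨u, hu, hua⟩ := exists_dbar_eq (c.isOpen_preimage _)
    (P.contDiffOn_form (P.isFrame x) c).neg hmem
  -- Positivity of this product means lying on the same side of the real axis as `z₀`; it makes `O`
  -- disjoint from its conjugate.
  have hside : ∀ᶠ z in 𝓝 z₀.1, 0 < z.im * z₀.1.im := by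
    have h1 : Continuous fun z : ℂ => z.im * z₀.1.im := Complex.continuous_im.mul continuous_const
    exact h1.continuousAt.eventually (lt_mem_nhds (mul_self_pos.2 z₀.2))
  obtain ⟨O, hO', hO, hzO⟩ := eventually_nhds_iff.1
    ((hua.and hside).and ((c.isOpen_preimage _).mem_nhds hmem))
  have hOU : c.opens hO ≤ P.U x := c.opens_le hO fun z hz => (hO' z hz).2
  -- `u` need not commute with conjugation. It is kept on the side of `z₀` and reflected to the
  -- other side, so that `exp v` descends to the surface.
  let v : ℂ → ℂ := fun z => if 0 < z.im * z₀.1.im then u z else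
    starRingEnd ℂ (u (starRingEnd ℂ z))
  have hside' : ∀ z ∈ c.preimage (c.opens hO),
      0 < z.im * z₀.1.im ∨ (z.im * z₀.1.im < 0) := by
    intro z hz
    rcases c.mem_preimage_opens hz with h | h
    · exact Or.inl (hO' z h).1.2
    · have := (hO' _ h).1.2
      rw [Complex.conj_im] at this
      exact Or.inr (by linarith)
  have hvpos : ∀ z : ℂ, 0 < z.im * z₀.1.im → v =ᶠ[𝓝 z] u := by
    intro z hz
    have h1 : Continuous fun z : ℂ => z.im * z₀.1.im := Complex.continuous_im.mul continuous_const
    filter_upwards [h1.continuousAt.eventually (lt_mem_nhds hz)] with w hw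
    exact if_pos hw
  have hvneg : ∀ z : ℂ, z.im * z₀.1.im < 0 →
      v =ᶠ[𝓝 z] fun z => starRingEnd ℂ (u (starRingEnd ℂ z)) := by
    intro z hz
    have h1 : Continuous fun z : ℂ => z.im * z₀.1.im := Complex.continuous_im.mul continuous_const
    filter_upwards [h1.continuousAt.eventually (gt_mem_nhds hz)] with w hw
    exact if_neg (not_lt.2 hw.le)
  have hv : ContDiffOn ℝ ∞ v (c.preimage (c.opens hO)) := by
    intro z hz
    refine ContDiffAt.contDiffWithinAt ?_
    rcases hside' z hz with h | h
    · exact hu.contDiffAt.congr_of_eventuallyEq (hvpos z h)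
    · refine ContDiffAt.congr_of_eventuallyEq ?_ (hvneg z h)
      exact (Complex.conjCLE.contDiff.comp (hu.comp Complex.conjCLE.contDiff)).contDiffAt
  have hvc : ∀ z ∈ c.preimage (c.opens hO), v (starRingEnd ℂ z) = starRingEnd ℂ (v z) := by
    intro z hz
    rcases hside' z hz with h | h
    · have h' : ¬ 0 < (starRingEnd ℂ z).im * z₀.1.im := by
        rw [Complex.conj_im]; linarith
      simp only [v, if_pos h, if_neg h', Complex.conj_conj]
    · have h' : 0 < (starRingEnd ℂ z).im * z₀.1.im := by
        rw [Complex.conj_im]; linarith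
      simp only [v, if_neg (not_lt.2 h.le), if_pos h', Complex.conj_conj]
  obtain ⟨r, hr⟩ := Smooth.exists_read_eq c (c.opens_le_image hO) (g := fun z => Complex.exp (v z))
    hv.cexp (fun z hz => by rw [hvc z hz, Complex.exp_conj])
  obtain ⟨r', hr'⟩ := Smooth.exists_read_eq c (c.opens_le_image hO)
    (g := fun z => Complex.exp (-v z)) hv.neg.cexp
    (fun z hz => by rw [hvc z hz, ← map_neg, Complex.exp_conj])
  have hrr : r * r' = 1 := by
    refine Smooth.ext_read c (c.opens_le_image hO) fun z hz => ?_
    rw [Smooth.read_mul, hr z hz, hr' z hz, Smooth.read_one c hz, ← Complex.exp_add, add_neg_cancel,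
      Complex.exp_zero]
  refine ⟨c.opens hO, r • res M hOU (P.e x), (c.mem_opens hO).2 ⟨z₀, hz₀, hzO, rfl⟩,
    (P.isFrame x).smul_res hOU hrr, P.isParallel_of_chart c hO ?_⟩
  rintro z ⟨hzO, hz⟩
  have h1 : r.read c =ᶠ[𝓝 z] fun w => Complex.exp (u w) := by
    filter_upwards [(c.isOpen_preimage _).mem_nhds hz, hvpos z (hO' z hzO).1.2] with w hw hw'
    rw [hr w hw, hw']
  rw [P.form_smul (P.isFrame x) hOU le_rfl hrr (res_self M _) c hz, dbar_congr h1, h1.eq_of_nhds,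
    dbar_exp (hu.differentiable (by simp) z), mul_div_cancel_left₀ _ (Complex.exp_ne_zero _),
    (hO' z hzO).1.1]
  simp

/-- Parallel frames differ by sections of the structure sheaf. -/
theorem exists_eq_onSections_smul (c : KleinChart X) {x : X.toLRS} (hx : x ∈ c.image)
    {V V' : Opens X.toLRS} {m : M.val.obj (op V)} {m' : M.val.obj (op V')} (hm : IsFrame M m)
    (hm' : IsFrame M m') (hp : P.IsParallel m) (hp' : P.IsParallel m') (hxV : x ∈ V)
    (hxV' : x ∈ V') : ∃ (W : Opens X.toLRS) (hW : W ≤ V) (hW' : W ≤ V'), x ∈ W ∧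
      ∃ r : (ringSheaf X.toLRS.sheaf).obj.obj (op W),
        res M hW' m' = onSections (toSmooth X) W r • res M hW m := by
  obtain ⟨t, ht⟩ := exists_coeff_mul_eq_one hm hm'
  have h1 := (coeff_smul hm m').symm
  -- Both forms vanish, so by `form_smul` the transition function `h` satisfies `∂̄h / h = 0`, and
  -- `h` has no zeros.
  obtain ⟨f, hf⟩ := (coeff hm m').exists_onSections_eq (fun c z hz => by
    have h2 := P.form_smul hm inf_le_right inf_le_left ht h1 c hz
    rw [hp c z (c.preimage_mono inf_le_right hz), hp' c z (c.preimage_mono inf_le_left hz), zero_add]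
      at h2
    exact (div_eq_zero_iff.1 h2.symm).resolve_right (Smooth.read_ne_zero ht c hz)) c
  refine ⟨V' ⊓ V ⊓ c.image, inf_le_left.trans inf_le_right, inf_le_left.trans inf_le_left,
    ⟨⟨hxV', hxV⟩, hx⟩, f, ?_⟩
  have h3 := congrArg (res M (inf_le_left : V' ⊓ V ⊓ c.image ≤ V' ⊓ V)) h1
  rw [res_smul, res_res, res_res] at h3
  rw [h3, ← hf]

/-- The family of the parallel frames. -/
def parallelFrames (hX : ∀ x : X.toLRS, ∃ c : KleinChart X, x ∈ c.image) :
    FrameFamily (toSmooth X) M where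
  ι := {m : Σ V : Opens X.toLRS, M.val.obj (op V) // IsFrame M m.2 ∧ P.IsParallel m.2}
  U m := m.1.1
  e m := m.1.2
  exists_mem x := by
    obtain ⟨c, hc⟩ := hX x
    obtain ⟨V, m, hxV, hm, hp⟩ := P.exists_isParallel c hc
    exact ⟨⟨⟨V, m⟩, hm, hp⟩, hxV⟩
  isFrame m := m.2.1
  compat m m' x hx hx' := by
    obtain ⟨c, hc⟩ := hX x
    exact P.exists_eq_onSections_smul c hc m.2.1 m'.2.1 m.2.2 m'.2.2 hx hx'

end FramePartition

theorem IsInvertibleSheaf.nonempty_framePartition [T2Space X.toLRS] [CompactSpace X.toLRS]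
    (hX : ∀ x : X.toLRS, ∃ c : KleinChart X, x ∈ c.image) (hM : IsInvertibleSheaf M) :
    Nonempty (FramePartition M) := by
  choose U hU e he using hM
  obtain ⟨T, ρ, hρ, hsum⟩ := exists_partition hX U hU
  exact ⟨⟨U, e, he, hU, T, ρ, hρ, hsum⟩⟩

end Connection

end Klein

end

/-! ### The theorem: descent along the parallel frames. -/

theorem theorem3p3 (S : Klein.KleinSurface)
    (L' : SheafOfModules.{0} (Klein.ringSheaf (Klein.smoothSheaf S.toRealRingedSpace)))
    (hL' : Klein.IsInvertibleSheaf L') :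
    ∃ L : SheafOfModules.{0} (Klein.ringSheaf S.toLRS.sheaf),
      Klein.IsInvertibleSheaf L ∧
        Nonempty (Klein.sheafExtendScalars (Klein.toSmooth S.toRealRingedSpace) L ≅ L') := by
  have := S.compactSpace
  have := S.t2Space
  obtain ⟨P⟩ := hL'.nonempty_framePartition S.exists_chart
  exact (P.parallelFrames S.exists_chart).exists_isInvertibleSheaf
    (Klein.onSections_toSmooth_injective S.exists_chart)
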